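/- Place one qubit at each site of the $D$-dimensional hypercubic lattice $\Lambda=\{1,\dots,L\}^D$, $D\ge 1$, with open or periodic boundary conditions. A local commuting projector code with interaction range $w$ is given by a finite set $\mathcal S$ of mutually commuting orthogonal projectors on $(\mathbb C^2)^{\otimes\Lambda}$, each of which acts trivially outside some hypercube of linear size $w$; its code space is the simultaneous eigenspace with eigenvalue one of all projectors in $\mathcal S$. The code is nontrivial if its code space has dimension greater than one. An operator is a nontrivial logical operator if it preserves the code space and its restriction to the code space is not proportional to the identity. A slab of width $r$ is a set $\{i,i+1,\dots,i+r-1\}\times\{1,\dots,L\}^{D-1}$, where the first coordinates are read modulo $L$ if the boundary conditions are periodic; if $r>L$, a slab of width $r$ means the whole lattice. A set $M$ of qubits is correctable if the erasure of $M$ (the partial trace over $M$) can be reversed on all states of the code space by a trace-preserving completely positive recovery map, and the distance $d$ of the code is the minimum size of a noncorrectable set of qubits. Theorem. For every nontrivial local commuting projector code in $D\ge 1$ dimensions with interaction range $w>1$ (and either boundary condition): (i) there is a nontrivial unitary logical operator that commutes with all projectors in $\mathcal S$ and is supported on a slab of width $5(w-1)$; (ii) there is a noncorrectable slab of width $3(w-1)$;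 (iii) the distance satisfies $d\le 3(w-1)L^{D-1}$. -/

import Mathlib

open scoped ComplexOrder

/-! ### Qubit systems, supports of operators, partial traces, quantum channels -/

/-- Computational basis labels of the qubits sitting at the points of `V`. -/
abbrev QConfig (V : Type) : Type := V → Fin 2

/-- Operators on the Hilbert space `(ℂ²)^{⊗ V}`, as matrices in the computational basis. -/
abbrev QOp (V : Type) : Type := Matrix (QConfig V) (QConfig V) ℂ

/-- `O` is supported on the set of qubits `M`: it has the form `A ⊗ 1`, where `A` acts on the
qubits of `M` and `1` is the identity on the remaining qubits. -/
def SupportedOn {V : Type} (M : Finset V) (O : QOp V) : Prop :=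
  ∃ A : QOp {s // s ∈ M}, ∀ x y : QConfig V,
    ((∀ s, s ∉ M → x s = y s) → O x y = A (fun s => x s) (fun s => y s)) ∧
    ((∃ s, s ∉ M ∧ x s ≠ y s) → O x y = 0)

/-- The basis label of the whole system that is `m` on `M` and `x` outside `M`. -/
def glueConfig {V : Type} [DecidableEq V] (M : Finset V)
    (m : QConfig {s // s ∈ M}) (x : QConfig {s // s ∉ M}) : QConfig V :=
  fun s => if h : s ∈ M then m ⟨s, h⟩ else x ⟨s, h⟩

/-- Erasure of the qubits in `M`: the partial trace over `M`. -/
def eraseQubits {V : Type} [DecidableEq V] (M : Finset V) (ρ : QOp V) : QOp {s // s ∉ M} :=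
  Matrix.of fun x y => ∑ m : QConfig {s // s ∈ M}, ρ (glueConfig M m x) (glueConfig M m y)

/-- `Φ` is completely positive: `id_n ⊗ Φ` preserves positive semidefiniteness for every `n`. -/
def IsCompletelyPositive {α β : Type} (Φ : Matrix α α ℂ →ₗ[ℂ] Matrix β β ℂ) : Prop :=
  ∀ (n : ℕ) (X : Matrix (Fin n × α) (Fin n × α) ℂ), X.PosSemidef →
    (Matrix.of fun (p q : Fin n × β) =>
      Φ (Matrix.of fun k l => X (p.1, k) (q.1, l)) p.2 q.2).PosSemidef

/-- `Φ` preserves the trace. -/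
def IsTracePreserving {α β : Type} [Fintype α] [Fintype β]
    (Φ : Matrix α α ℂ →ₗ[ℂ] Matrix β β ℂ) : Prop :=
  ∀ X, (Φ X).trace = X.trace

/-! ### The hypercubic lattice -/

/-- The two kinds of boundary conditions. -/
inductive BoundaryCondition
  | openBoundary
  | periodicBoundary

/-- The sites of the `D`-dimensional hypercubic lattice of linear size `L`. -/
abbrev LatticeSite (D L : ℕ) : Type := Fin D → Fin L

/-- The coordinates `i, i + 1, …, i + r - 1`; they are truncated to the lattice for open boundary
conditions, and read modulo `L` for periodic ones. -/
def coordRange (b : BoundaryCondition) (L i r : ℕ) : Set (Fin L) :=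
  match b with
  | .openBoundary => {x | i ≤ (x : ℕ) ∧ (x : ℕ) < i + r}
  | .periodicBoundary => {x | ∃ t < r, (x : ℕ) = (i + t) % L}

open Classical in
/-- The hypercube of linear size `w` with corner `c`. -/
noncomputable def hypercube (b : BoundaryCondition) {D L : ℕ} (w : ℕ) (c : LatticeSite D L) :
    Finset (LatticeSite D L) :=
  Finset.univ.filter fun x => ∀ j, x j ∈ coordRange b L (c j) w

/-- `S` is a slab of width `r`: the set `{i, …, i + r - 1} × {all}^{D-1}`, where `r ≤ L`.
For open boundary conditions the slab lies inside the lattice without wrapping around. -/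
def IsSlab (b : BoundaryCondition) {D L : ℕ} (hD : 1 ≤ D) (r : ℕ)
    (S : Finset (LatticeSite D L)) : Prop :=
  r ≤ L ∧ ∃ i : Fin L, (b = .openBoundary → (i : ℕ) + r ≤ L) ∧
    ∀ x, x ∈ S ↔ x ⟨0, hD⟩ ∈ coordRange b L i r

/-! ### Local commuting projector codes -/

/-- A commuting projector code with interaction range `w`, with one qubit at each lattice site:
a finite set of mutually commuting orthogonal projectors, each supported on a hypercube of linear
size `w`. -/
structure LocalCommutingProjectorCode (b : BoundaryCondition) (D L w : ℕ) where
  projectors : Finset (QOp (LatticeSite D L))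
  isProjection : ∀ P ∈ projectors, IsStarProjection P
  commute : ∀ P ∈ projectors, ∀ Q ∈ projectors, Commute P Q
  local_range : ∀ P ∈ projectors, ∃ c : LatticeSite D L, SupportedOn (hypercube b w c) P

namespace LocalCommutingProjectorCode

variable {b : BoundaryCondition} {D L w : ℕ}

/-- The code space: the simultaneous eigenspace with eigenvalue one of the projectors. -/
def codeSpace (C : LocalCommutingProjectorCode b D L w) :
    Submodule ℂ (QConfig (LatticeSite D L) → ℂ) where
  carrier := {v | ∀ P ∈ C.projectors, Matrix.mulVec P v = v}
  add_mem' := by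
    intro u v hu hv P hP
    rw [Matrix.mulVec_add, hu P hP, hv P hP]
  zero_mem' := by
    intro P _
    exact Matrix.mulVec_zero P
  smul_mem' := by
    intro a v hv P hP
    rw [Matrix.mulVec_smul, hv P hP]

/-- The code is nontrivial: the dimension of the code space is greater than one. -/
def IsNontrivial (C : LocalCommutingProjectorCode b D L w) : Prop :=
  1 < Module.finrank ℂ C.codeSpace

/-- `O` is a logical operator: it preserves the code space. -/
def IsLogical (C : LocalCommutingProjectorCode b D L w) (O : QOp (LatticeSite D L)) : Prop :=
  ∀ v ∈ C.codeSpace, Matrix.mulVec O v ∈ C.codeSpace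

/-- `O` is a nontrivial logical operator: it preserves the code space, and its restriction to the
code space is not proportional to the identity. -/
def IsNontrivialLogical (C : LocalCommutingProjectorCode b D L w)
    (O : QOp (LatticeSite D L)) : Prop :=
  C.IsLogical O ∧ ¬ ∃ c : ℂ, ∀ v ∈ C.codeSpace, Matrix.mulVec O v = c • v

/-- `ρ` is a code state: a density operator whose range lies in the code space. -/
def IsCodeState (C : LocalCommutingProjectorCode b D L w) (ρ : QOp (LatticeSite D L)) : Prop :=
  ρ.PosSemidef ∧ ρ.trace = 1 ∧ ∀ v, Matrix.mulVec ρ v ∈ C.codeSpace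

/-- `M` is correctable: erasure of the qubits in `M` is reversed, on all code states, by a
trace-preserving completely positive recovery map. -/
def IsCorrectable (C : LocalCommutingProjectorCode b D L w)
    (M : Finset (LatticeSite D L)) : Prop :=
  ∃ R : QOp {s // s ∉ M} →ₗ[ℂ] QOp (LatticeSite D L),
    IsCompletelyPositive R ∧ IsTracePreserving R ∧
    ∀ ρ, C.IsCodeState ρ → R (eraseQubits M ρ) = ρ

/-- `d` is the distance of the code: the minimum size of a noncorrectable set of qubits. -/
def IsDistance (C : LocalCommutingProjectorCode b D L w) (d : ℕ) : Prop :=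
  IsLeast {n : ℕ | ∃ M : Finset (LatticeSite D L), M.card = n ∧ ¬ C.IsCorrectable M} d

end LocalCommutingProjectorCode

/-!
Let `Q` be the projection onto the code space, the product of all projectors of the code, and let
`m = w - 1`. A region `M` satisfies the Knill–Laflamme condition if `Q * O * Q` is a multiple of
`Q` for every operator `O` on `M`. The proof locates a thin slab that violates this condition.

* Correctable regions satisfy the condition (`knillLaflamme_of_recovery`). Given orthogonal code
  vectors `u` and `v` and a matrix unit `E` of `M`, the erased `E u` is dominated by the erased
  `u`, so that the recovery map sends it to a multiple of the state `u`; since positive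
  trace-preserving maps cannot make vectors more distinguishable, `E u` was orthogonal to `v`
  already.
* If two regions satisfy the condition and no projector touches both, their union satisfies it
  (`KnillLaflamme.union`). In `Q * (A * B) * Q` with `A` and `B` on the two regions, the projectors
  that make up `Q` can be moved between `A` and `B`, which gives `(Q * A * Q) * (Q * B * Q)`.
* A region and its complement cannot both satisfy the condition if the code is nontrivial
  (`KnillLaflamme.eq_zero_of_compl`); this is a form of the no-cloning theorem.

If `3 * m < L`, cut the range of the first coordinate into an even number of blocks of length at
least `m` and less than `3 * m`. A hypercube of linear size `w = m + 1` touches at most one of the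
even blocks and at most one of the odd ones. If every block satisfied the Knill–Laflamme condition,
so would the union of the even blocks and the union of the odd ones, which are complementary. So
some block violates it, and a slab of width `3 * m` that contains the block is not correctable. If
`L ≤ 3 * m`, the whole lattice takes the place of the block. The bound on the distance counts the
sites of the slab.

For the logical operator, take `O` on the bad block `B` with `Q * O * Q` not a multiple of `Q`, and
let `K` be the product of the projectors that touch `B`. Then `K * O * K` commutes with all
projectors, has the same compression as `O`, and lives on a slab of width `5 * m`. One of its
Hermitian parts is a nontrivial logical operator too, and the Cayley transform makes it unitary
(`exists_unitary_of_not_smul`).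
-/

/-! ### Operators supported on a region -/

section Region

open scoped Kronecker

variable {V : Type} [Fintype V] [DecidableEq V]

/-- Basis labels of the whole system, split into the labels inside and outside `M`. -/
def splitConfig (M : Finset V) :
    QConfig V ≃ QConfig {s // s ∈ M} × QConfig {s // s ∉ M} :=
  Equiv.piEquivPiSubtypeProd (fun s => s ∈ M) fun _ => Fin 2

omit [Fintype V] in
lemma splitConfig_symm_apply (M : Finset V)
    (p : QConfig {s // s ∈ M} × QConfig {s // s ∉ M}) :
    (splitConfig M).symm p = glueConfig M p.1 p.2 := rfl

/-- The embedding `A ↦ A ⊗ 1` of the operators on `M` into the operators on all qubits. -/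
def onRegion (M : Finset V) : QOp {s // s ∈ M} →⋆ₐ[ℂ] QOp V where
  toFun A := (A ⊗ₖ (1 : QOp {s // s ∉ M})).submatrix (splitConfig M) (splitConfig M)
  map_one' := by simp
  map_mul' A B := by
    rw [Matrix.submatrix_mul_equiv, ← Matrix.mul_kronecker_mul, one_mul]
  map_zero' := by simp
  map_add' A B := by rw [Matrix.add_kronecker]; rfl
  commutes' c := by
    rw [Algebra.algebraMap_eq_smul_one, Algebra.algebraMap_eq_smul_one, Matrix.smul_kronecker,
      Matrix.one_kronecker_one]
    exact congrArg (fun X : QOp V => c • X) (Matrix.submatrix_one_equiv (splitConfig M))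
  map_star' A := by
    simp [Matrix.star_eq_conjTranspose, Matrix.conjTranspose_kronecker]

/-- The operator `1 ⊗ B`, where `B` acts on the qubits outside `M`. -/
def offRegion (M : Finset V) (B : QOp {s // s ∉ M}) : QOp V :=
  ((1 : QOp {s // s ∈ M}) ⊗ₖ B).submatrix (splitConfig M) (splitConfig M)

lemma commute_onRegion_offRegion (M : Finset V) (A : QOp {s // s ∈ M}) (B : QOp {s // s ∉ M}) :
    Commute (onRegion M A) (offRegion M B) := by
  change (_ ⊗ₖ _).submatrix _ _ * (_ ⊗ₖ _).submatrix _ _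
    = (_ ⊗ₖ _).submatrix _ _ * (_ ⊗ₖ _).submatrix _ _
  simp only [Matrix.submatrix_mul_equiv, ← Matrix.mul_kronecker_mul, one_mul, mul_one]

lemma onRegion_apply_of_agree (M : Finset V) (A : QOp {s // s ∈ M}) {x y : QConfig V}
    (h : ∀ s, s ∉ M → x s = y s) :
    onRegion M A x y = A (fun s => x s) (fun s => y s) := by
  have : (fun s : {s // s ∉ M} => x s) = fun s : {s // s ∉ M} => y s := funext fun s => h s s.2
  change A (fun s => x s) (fun s => y s) *
    (1 : QOp {s // s ∉ M}) (fun s => x s) (fun s => y s) = _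
  rw [this, Matrix.one_apply_eq, mul_one]

lemma onRegion_apply_of_ne (M : Finset V) (A : QOp {s // s ∈ M}) {x y : QConfig V}
    (h : ∃ s, s ∉ M ∧ x s ≠ y s) : onRegion M A x y = 0 := by
  obtain ⟨s, hs, hne⟩ := h
  have : (fun s : {s // s ∉ M} => x s) ≠ fun s : {s // s ∉ M} => y s :=
    fun e => hne (congrFun e ⟨s, hs⟩)
  change A (fun s => x s) (fun s => y s) *
    (1 : QOp {s // s ∉ M}) (fun s => x s) (fun s => y s) = _
  rw [Matrix.one_apply_ne this, mul_zero]

omit [Fintype V] in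
lemma offRegion_apply_of_agree (M : Finset V) (B : QOp {s // s ∉ M}) {x y : QConfig V}
    (h : ∀ s, s ∈ M → x s = y s) :
    offRegion M B x y = B (fun s => x s) (fun s => y s) := by
  have : (fun s : {s // s ∈ M} => x s) = fun s : {s // s ∈ M} => y s := funext fun s => h s s.2
  change (1 : QOp {s // s ∈ M}) (fun s => x s) (fun s => y s) *
    B (fun s => x s) (fun s => y s) = _
  rw [this, Matrix.one_apply_eq, one_mul]

omit [Fintype V] in
lemma offRegion_apply_of_ne (M : Finset V) (B : QOp {s // s ∉ M}) {x y : QConfig V}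
    (h : ∃ s, s ∈ M ∧ x s ≠ y s) : offRegion M B x y = 0 := by
  obtain ⟨s, hs, hne⟩ := h
  have : (fun s : {s // s ∈ M} => x s) ≠ fun s : {s // s ∈ M} => y s :=
    fun e => hne (congrFun e ⟨s, hs⟩)
  change (1 : QOp {s // s ∈ M}) (fun s => x s) (fun s => y s) *
    B (fun s => x s) (fun s => y s) = _
  rw [Matrix.one_apply_ne this, zero_mul]

lemma supportedOn_iff_exists_onRegion {M : Finset V} {O : QOp V} :
    SupportedOn M O ↔ ∃ A, onRegion M A = O := by
  constructor
  · rintro ⟨A, hA⟩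
    refine ⟨A, Matrix.ext fun x y => ?_⟩
    by_cases h : ∀ s, s ∉ M → x s = y s
    · rw [onRegion_apply_of_agree M A h, (hA x y).1 h]
    · push Not at h
      rw [onRegion_apply_of_ne M A h, (hA x y).2 h]
  · rintro ⟨A, rfl⟩
    exact ⟨A, fun x y => ⟨onRegion_apply_of_agree M A, onRegion_apply_of_ne M A⟩⟩

omit [Fintype V] in
/-- A description of `SupportedOn` by matrix elements alone: they vanish unless the labels agree
outside `M`, and are unchanged when both labels are modified in the same way outside `M`. -/
lemma supportedOn_iff_entries {M : Finset V} {O : QOp V} :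
    SupportedOn M O ↔ (∀ x y : QConfig V, (∃ s, s ∉ M ∧ x s ≠ y s) → O x y = 0) ∧
      ∀ x y x' y' : QConfig V, (∀ s, s ∉ M → x s = y s) → (∀ s, s ∉ M → x' s = y' s) →
        (∀ s, s ∈ M → x s = x' s ∧ y s = y' s) → O x y = O x' y' := by
  constructor
  · rintro ⟨A, hA⟩
    refine ⟨fun x y => (hA x y).2, fun x y x' y' h h' he => ?_⟩
    rw [(hA x y).1 h, (hA x' y').1 h']
    congr 1
    · exact funext fun s => (he s s.2).1
    · exact funext fun s => (he s s.2).2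
  · rintro ⟨h0, h1⟩
    refine ⟨fun a b => O (glueConfig M a 0) (glueConfig M b 0), fun x y => ⟨fun h => ?_, h0 x y⟩⟩
    refine h1 _ _ _ _ h (fun s hs => by simp [glueConfig, hs]) fun s hs => ?_
    simp [glueConfig, hs]

omit [Fintype V] in
lemma SupportedOn.mono {M N : Finset V} (hMN : M ⊆ N) {O : QOp V} (h : SupportedOn M O) :
    SupportedOn N O := by
  rw [supportedOn_iff_entries] at h ⊢
  refine ⟨fun x y ⟨s, hs, hne⟩ => h.1 x y ⟨s, fun hM => hs (hMN hM), hne⟩,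
    fun x y x' y' hxy hxy' he => ?_⟩
  by_cases hag : ∀ s, s ∉ M → x s = y s
  · refine h.2 _ _ _ _ hag (fun s hs => ?_) fun s hs => he s (hMN hs)
    by_cases hN : s ∈ N
    · rw [← (he s hN).1, ← (he s hN).2, hag s hs]
    · exact hxy' s hN
  · push Not at hag
    rw [h.1 x y hag]
    obtain ⟨s, hs, hne⟩ := hag
    have hN : s ∈ N := by
      by_contra hN
      exact hne (hxy s hN)
    rw [h.1 x' y' ⟨s, hs, by rwa [← (he s hN).1, ← (he s hN).2]⟩]

lemma supportedOn_compl_iff {M : Finset V} {O : QOp V} :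
    SupportedOn Mᶜ O ↔ ∃ B, offRegion M B = O := by
  constructor
  · intro h
    rw [supportedOn_iff_entries] at h
    refine ⟨Matrix.of fun a b => O (glueConfig M 0 a) (glueConfig M 0 b), Matrix.ext fun x y => ?_⟩
    by_cases hag : ∀ s, s ∈ M → x s = y s
    · rw [offRegion_apply_of_agree M _ hag]
      refine h.2 _ _ _ _ (fun s hs => ?_) (fun s hs => ?_) fun s hs => ?_
      · have : s ∈ M := by simpa using hs
        simp [glueConfig, this]
      · exact hag s (by simpa using hs)
      · have : s ∉ M := by simpa using hs
        simp [glueConfig, this]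
    · push Not at hag
      rw [offRegion_apply_of_ne M _ hag]
      obtain ⟨s, hs, hne⟩ := hag
      rw [h.1 x y ⟨s, by simpa using hs, hne⟩]
  · rintro ⟨B, rfl⟩
    rw [supportedOn_iff_entries]
    refine ⟨fun x y ⟨s, hs, hne⟩ =>
      offRegion_apply_of_ne M B ⟨s, by simpa using hs, hne⟩, fun x y x' y' h h' he => ?_⟩
    rw [offRegion_apply_of_agree M B fun s hs => h s (by simpa using hs),
      offRegion_apply_of_agree M B fun s hs => h' s (by simpa using hs)]
    congr 1
    · exact funext fun s => (he s (by simpa using s.2)).1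
    · exact funext fun s => (he s (by simpa using s.2)).2

lemma SupportedOn.mul {M : Finset V} {O O' : QOp V} (h : SupportedOn M O)
    (h' : SupportedOn M O') : SupportedOn M (O * O') := by
  rw [supportedOn_iff_exists_onRegion] at *
  obtain ⟨A, rfl⟩ := h
  obtain ⟨A', rfl⟩ := h'
  exact ⟨A * A', map_mul _ _ _⟩

lemma SupportedOn.commute {M N : Finset V} (hMN : Disjoint M N) {O O' : QOp V}
    (h : SupportedOn M O) (h' : SupportedOn N O') : Commute O O' := by
  obtain ⟨A, rfl⟩ := supportedOn_iff_exists_onRegion.1 h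
  obtain ⟨B, rfl⟩ := supportedOn_compl_iff.1
    (h'.mono fun s hs => Finset.mem_compl.2 fun hM => Finset.disjoint_left.1 hMN hM hs)
  exact commute_onRegion_offRegion M A B

/-- The operator on the qubits outside `M` given by the block of `O` between the labels `a` and
`b` of `M`. -/
def regionBlock (M : Finset V) (O : QOp V) (a b : QConfig {s // s ∈ M}) : QOp {s // s ∉ M} :=
  Matrix.of fun x y => O (glueConfig M a x) (glueConfig M b y)

lemma onRegion_single_mul_offRegion_apply (M : Finset V) (a b : QConfig {s // s ∈ M})
    (B : QOp {s // s ∉ M}) (x y : QConfig V) :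
    (onRegion M (Matrix.single a b 1) * offRegion M B) x y =
      if a = (fun s => x s.1) ∧ b = (fun s => y s.1) then
        B (fun s => x s) (fun s => y s) else 0 := by
  have h : onRegion M (Matrix.single a b 1) * offRegion M B
      = (Matrix.single a b 1 ⊗ₖ B).submatrix (splitConfig M) (splitConfig M) := by
    change (_ ⊗ₖ _).submatrix _ _ * (_ ⊗ₖ _).submatrix _ _ = _
    rw [Matrix.submatrix_mul_equiv, ← Matrix.mul_kronecker_mul, one_mul, mul_one]
  rw [h]
  change Matrix.single a b (1 : ℂ) (fun s => x s.1) (fun s => y s.1) * B _ _ = _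
  rw [Matrix.single_apply]
  split_ifs
  · exact one_mul _
  · exact zero_mul _

/-- Expansion of an operator along the matrix units of `M`. -/
lemma eq_sum_onRegion_mul_offRegion (M : Finset V) (O : QOp V) :
    O = ∑ a, ∑ b, onRegion M (Matrix.single a b 1) * offRegion M (regionBlock M O a b) := by
  ext x y
  simp only [Matrix.sum_apply, onRegion_single_mul_offRegion_apply]
  rw [Finset.sum_eq_single (fun s => x s.1), Finset.sum_eq_single (fun s => y s.1)]
  · simp only [and_self, if_true, regionBlock]
    congr 1 <;>
    · ext s
      by_cases hs : s ∈ M <;> simp [glueConfig, hs]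
  · intro b _ hb
    simp [hb]
  · simp
  · intro a _ ha
    simp [ha]
  · simp

lemma supportedOn_offRegion_regionBlock {M N : Finset V} (hMN : Disjoint M N) {O : QOp V}
    (h : SupportedOn (M ∪ N) O) (a b : QConfig {s // s ∈ M}) :
    SupportedOn N (offRegion M (regionBlock M O a b)) := by
  rw [supportedOn_iff_entries] at h ⊢
  constructor
  · rintro x y ⟨s, hs, hne⟩
    by_cases hag : ∀ s, s ∈ M → x s = y s
    · have hM : s ∉ M := fun hM => hne (hag s hM)
      rw [offRegion_apply_of_agree M _ hag]
      exact h.1 _ _ ⟨s, by simp [hs, hM], by simpa [glueConfig, hM] using hne⟩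
    · push Not at hag
      exact offRegion_apply_of_ne M _ hag
  · intro x y x' y' hxy hxy' he
    have hN {s} (hs : s ∈ M) : s ∉ N := Finset.disjoint_left.1 hMN hs
    rw [offRegion_apply_of_agree M _ fun s hs => hxy s (hN hs),
      offRegion_apply_of_agree M _ fun s hs => hxy' s (hN hs)]
    refine h.2 _ _ _ _ (fun s hs => ?_) (fun s hs => ?_) fun s hs => ?_
    · rw [Finset.mem_union, not_or] at hs
      simpa [glueConfig, hs.1] using hxy s hs.2
    · rw [Finset.mem_union, not_or] at hs
      simpa [glueConfig, hs.1] using hxy' s hs.2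
    · by_cases hM : s ∈ M
      · simp [glueConfig, hM]
      · simpa [glueConfig, hM] using he s ((Finset.mem_union.1 hs).resolve_left hM)

end Region

/-! ### The projection onto the common fixed space of commuting projections -/

section JointProjection

variable {n : Type} [Fintype n] [DecidableEq n]

/-- `Q` is the projection onto the common fixed space of the commuting projections in `T`.
Membership in the generated monoid records that `Q` is a product of elements of `T`. -/
structure IsJointProjection (T : Finset (Matrix n n ℂ)) (Q : Matrix n n ℂ) : Prop where
  mem_closure : Q ∈ Submonoid.closure (T : Set (Matrix n n ℂ))
  isStarProjection : IsStarProjection Q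
  mul_eq_self : ∀ P ∈ T, P * Q = Q

lemma exists_isJointProjection (T : Finset (Matrix n n ℂ))
    (hp : ∀ P ∈ T, IsStarProjection P) (hc : ∀ P ∈ T, ∀ Q ∈ T, Commute P Q) :
    ∃ Q, IsJointProjection T Q := by
  induction T using Finset.induction_on with
  | empty => exact ⟨1, one_mem _, .one _, by simp⟩
  | insert P T hP ih =>
    obtain ⟨Q, hQ⟩ := ih (fun R hR => hp R (Finset.mem_insert_of_mem hR)) fun R hR R' hR' =>
      hc R (Finset.mem_insert_of_mem hR) R' (Finset.mem_insert_of_mem hR')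
    have hPm := Finset.mem_insert_self P T
    have hPQ : Commute P Q := by
      have : Submonoid.closure (T : Set (Matrix n n ℂ)) ≤ Submonoid.centralizer {P} :=
        Submonoid.closure_le.2 fun R hR => Submonoid.mem_centralizer_iff.2 fun X hX => by
          rw [Set.mem_singleton_iff.1 hX]
          exact hc P hPm R (Finset.mem_insert_of_mem hR)
      exact Submonoid.mem_centralizer_iff.1 (this hQ.mem_closure) P rfl
    refine ⟨P * Q, mul_mem (Submonoid.subset_closure (Finset.mem_coe.2 hPm))
      (Submonoid.closure_mono (Finset.coe_subset.2 (Finset.subset_insert P T)) hQ.mem_closure),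
      (hp P hPm).mul hQ.isStarProjection hPQ, fun R hR => ?_⟩
    rcases Finset.mem_insert.1 hR with rfl | hR
    · rw [← mul_assoc, (hp R hPm).isIdempotentElem.eq]
    · rw [← mul_assoc, (hc R (Finset.mem_insert_of_mem hR) P hPm).eq, mul_assoc,
        hQ.mul_eq_self R hR]

namespace IsJointProjection

variable {T T₁ T₂ : Finset (Matrix n n ℂ)} {Q Q₁ Q₂ X : Matrix n n ℂ}

lemma commute (hQ : IsJointProjection T Q) (h : ∀ P ∈ T, Commute P X) : Commute Q X := by
  have : Submonoid.closure (T : Set (Matrix n n ℂ)) ≤ Submonoid.centralizer {X} :=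
    Submonoid.closure_le.2 fun R hR => Submonoid.mem_centralizer_iff.2 fun Y hY => by
      rw [Set.mem_singleton_iff.1 hY]
      exact (h R hR).eq.symm
  exact (Submonoid.mem_centralizer_iff.1 (this hQ.mem_closure) X rfl).symm

lemma mul_eq (hQ : IsJointProjection T Q) (h : ∀ P ∈ T, P * X = X) : Q * X = X := by
  refine Submonoid.closure_induction (motive := fun Y _ => Y * X = X) (fun P hP => h P hP)
    (one_mul X) (fun Y Z _ _ hY hZ => ?_) hQ.mem_closure
  rw [mul_assoc, hZ, hY]

lemma mulVec_eq_iff (hQ : IsJointProjection T Q) {v : n → ℂ} :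
    Matrix.mulVec Q v = v ↔ ∀ P ∈ T, Matrix.mulVec P v = v := by
  refine ⟨fun h P hP => ?_, fun h => ?_⟩
  · rw [← h, Matrix.mulVec_mulVec, hQ.mul_eq_self P hP]
  · refine Submonoid.closure_induction (motive := fun Y _ => Matrix.mulVec Y v = v)
      (fun P hP => h P hP) (Matrix.one_mulVec v) (fun Y Z _ _ hY hZ => ?_) hQ.mem_closure
    rw [← Matrix.mulVec_mulVec, hZ, hY]

lemma mul_self (hQ : IsJointProjection T Q) : Q * Q = Q :=
  hQ.isStarProjection.isIdempotentElem.eq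

lemma mul_of_mem (hQ : IsJointProjection T Q) {P : Matrix n n ℂ} (hP : P ∈ T)
    (hPs : IsStarProjection P) : Q * P = Q := by
  have h := congrArg star (hQ.mul_eq_self P hP)
  rwa [star_mul, hQ.isStarProjection.isSelfAdjoint.star_eq, hPs.isSelfAdjoint.star_eq] at h

lemma mul_eq_of_subset (hQ : IsJointProjection T Q) (hQ₁ : IsJointProjection T₁ Q₁)
    (h : T₁ ⊆ T) : Q₁ * Q = Q :=
  hQ₁.mul_eq fun P hP => hQ.mul_eq_self P (h hP)

lemma eq_mul_of_union (hQ : IsJointProjection T Q) (hQ₁ : IsJointProjection T₁ Q₁)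
    (hQ₂ : IsJointProjection T₂ Q₂) (hT : ∀ P, P ∈ T ↔ P ∈ T₁ ∨ P ∈ T₂)
    (hc : ∀ P ∈ T, ∀ R ∈ T, Commute P R) : Q₁ * Q₂ = Q := by
  have h₂ : Q₂ * Q = Q := hQ.mul_eq_of_subset hQ₂ fun P hP => (hT P).2 (.inr hP)
  have h₁ : Q₁ * Q = Q := hQ.mul_eq_of_subset hQ₁ fun P hP => (hT P).2 (.inl hP)
  have hcQ₁ {P} (hP : P ∈ T) : Commute Q₁ P :=
    hQ₁.commute fun R hR => hc R ((hT R).2 (.inl hR)) P hP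
  have hcQ₂ {P} (hP : P ∈ T) : Commute Q₂ P :=
    hQ₂.commute fun R hR => hc R ((hT R).2 (.inr hR)) P hP
  have hfix : Q * (Q₁ * Q₂) = Q₁ * Q₂ := hQ.mul_eq fun P hP => by
    rcases (hT P).1 hP with h | h
    · rw [← mul_assoc, hQ₁.mul_eq_self P h]
    · rw [← mul_assoc, ← (hcQ₁ hP).eq, mul_assoc, hQ₂.mul_eq_self P h]
  have hcomm : Commute Q (Q₁ * Q₂) :=
    hQ.commute fun P hP => ((hcQ₁ hP).symm.mul_right (hcQ₂ hP).symm)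
  rw [← hfix, hcomm.eq, mul_assoc, h₂, h₁]

end IsJointProjection

end JointProjection

/-! ### The Knill–Laflamme condition -/

section KnillLaflamme

variable {V : Type} [Fintype V] [DecidableEq V] {T : Finset (QOp V)} {Q : QOp V}
  {M N : Finset V}

/-- The Knill–Laflamme condition for the erasure of `M`, for the code space which is the range of
the projection `Q`: the compression of every operator on `M` to the code space is a scalar. -/
def KnillLaflamme (Q : QOp V) (M : Finset V) : Prop :=
  ∀ O, SupportedOn M O → ∃ c : ℂ, Q * O * Q = c • Q

lemma KnillLaflamme.mono (h : KnillLaflamme Q N) (hMN : M ⊆ N) : KnillLaflamme Q M :=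
  fun O hO => h O (hO.mono hMN)

lemma supportedOn_empty {O : QOp V} (h : SupportedOn ∅ O) : ∃ c : ℂ, O = c • (1 : QOp V) := by
  rw [supportedOn_iff_entries] at h
  refine ⟨O 0 0, Matrix.ext fun x y => ?_⟩
  rw [Matrix.smul_apply, smul_eq_mul]
  by_cases hxy : x = y
  · rw [hxy, Matrix.one_apply_eq, mul_one]
    exact h.2 _ _ _ _ (by simp) (by simp) (by simp)
  · rw [Matrix.one_apply_ne hxy, mul_zero]
    obtain ⟨s, hs⟩ := Function.ne_iff.1 hxy
    exact h.1 x y ⟨s, by simp, hs⟩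

lemma knillLaflamme_empty (hQ : Q * Q = Q) : KnillLaflamme Q ∅ := by
  intro O hO
  obtain ⟨c, rfl⟩ := supportedOn_empty hO
  exact ⟨c, by simp [hQ]⟩

/-- The union of two regions such that no projector touches both inherits the Knill–Laflamme
condition. If `Q = Q₁ * Q₂`, where `Q₁` collects the projectors away from `M` and `Q₂` those away
from `N`, then `Q * (A * B) * Q = (Q * A * Q) * (Q * B * Q)` for `A` on `M` and `B` on `N`. -/
lemma KnillLaflamme.union (hQ : IsJointProjection T Q) (hp : ∀ P ∈ T, IsStarProjection P)
    (hc : ∀ P ∈ T, ∀ R ∈ T, Commute P R) (hMN : Disjoint M N)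
    (hT : ∀ P ∈ T, (∀ O, SupportedOn M O → Commute P O) ∨ ∀ O, SupportedOn N O → Commute P O)
    (hM : KnillLaflamme Q M) (hN : KnillLaflamme Q N) : KnillLaflamme Q (M ∪ N) := by
  classical
  set T₁ := T.filter fun P => ∀ O, SupportedOn M O → Commute P O
  set T₂ := T.filter fun P => ∀ O, SupportedOn N O → Commute P O
  obtain ⟨Q₁, hQ₁⟩ := exists_isJointProjection T₁ (fun P hP => hp P (Finset.mem_filter.1 hP).1)
    fun P hP R hR => hc P (Finset.mem_filter.1 hP).1 R (Finset.mem_filter.1 hR).1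
  obtain ⟨Q₂, hQ₂⟩ := exists_isJointProjection T₂ (fun P hP => hp P (Finset.mem_filter.1 hP).1)
    fun P hP R hR => hc P (Finset.mem_filter.1 hP).1 R (Finset.mem_filter.1 hR).1
  have hQQ : Q₁ * Q₂ = Q := hQ.eq_mul_of_union hQ₁ hQ₂ (fun P => by
    simp only [T₁, T₂, Finset.mem_filter, ← and_or_left]
    exact ⟨fun h => ⟨h, hT P h⟩, fun h => h.1⟩) hc
  have hQ₂Q : Q₂ * Q = Q := hQ.mul_eq_of_subset hQ₂ (Finset.filter_subset _ _)
  have hQQ₁ : Q * Q₁ = Q := by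
    have h := congrArg star (hQ.mul_eq_of_subset hQ₁ (Finset.filter_subset _ _))
    rwa [star_mul, hQ.isStarProjection.isSelfAdjoint.star_eq,
      hQ₁.isStarProjection.isSelfAdjoint.star_eq] at h
  have key {A B : QOp V} (hA : SupportedOn M A) (hB : SupportedOn N B) :
      ∃ c : ℂ, Q * (A * B) * Q = c • Q := by
    obtain ⟨a, ha⟩ := hM A hA
    obtain ⟨b, hb⟩ := hN B hB
    have hA' : Q₁ * A = A * Q₁ := hQ₁.commute fun P hP => (Finset.mem_filter.1 hP).2 A hA
    have hB' : Q₂ * B = B * Q₂ := hQ₂.commute fun P hP => (Finset.mem_filter.1 hP).2 B hB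
    refine ⟨a * b, ?_⟩
    calc Q * (A * B) * Q = (Q * Q₁) * (A * B) * (Q₂ * Q) := by rw [hQQ₁, hQ₂Q]
      _ = Q * (Q₁ * A) * (B * Q₂) * Q := by noncomm_ring
      _ = Q * A * (Q₁ * Q₂) * B * Q := by rw [hA', ← hB']; noncomm_ring
      _ = Q * A * (Q * Q) * B * Q := by rw [hQQ, hQ.mul_self]
      _ = (Q * A * Q) * (Q * B * Q) := by noncomm_ring
      _ = (a * b) • Q := by
        rw [ha, hb, smul_mul_smul_comm, hQ.mul_self]
  intro O hO
  choose c hcO using fun a b => key (supportedOn_iff_exists_onRegion.2 ⟨Matrix.single a b 1, rfl⟩)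
    (supportedOn_offRegion_regionBlock hMN hO a b)
  refine ⟨∑ a, ∑ b, c a b, ?_⟩
  conv_lhs => rw [eq_sum_onRegion_mul_offRegion M O]
  simp only [Finset.mul_sum, Finset.sum_mul, hcO, Finset.sum_smul]

/-- The Knill–Laflamme condition on a region in terms of the inner products of code vectors. -/
lemma KnillLaflamme.exists_dotProduct (hQ : IsStarProjection Q) (h : KnillLaflamme Q M) {O : QOp V}
    (hO : SupportedOn M O) :
    ∃ c : ℂ, ∀ u v, Q.mulVec u = u → Q.mulVec v = v →
      star u ⬝ᵥ O.mulVec v = c * (star u ⬝ᵥ v) := by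
  obtain ⟨c, hc⟩ := h O hO
  refine ⟨c, fun u v hu hv => ?_⟩
  have hQs : Matrix.conjTranspose Q = Q := hQ.isSelfAdjoint.star_eq
  calc star u ⬝ᵥ O.mulVec v = star (Q.mulVec u) ⬝ᵥ O.mulVec (Q.mulVec v) := by rw [hu, hv]
    _ = star u ⬝ᵥ (Q * O * Q).mulVec v := by
      rw [Matrix.star_mulVec, hQs, ← Matrix.dotProduct_mulVec, Matrix.mulVec_mulVec,
        Matrix.mulVec_mulVec, mul_assoc]
    _ = c * (star u ⬝ᵥ v) := by
      rw [hc, Matrix.smul_mulVec, hv, dotProduct_smul, smul_eq_mul]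

/-- A vector of the whole system as a matrix, its rows labelled by `M` and its columns by the
complement of `M`. -/
def bipartite (M : Finset V) (u : QConfig V → ℂ) :
    Matrix (QConfig {s // s ∈ M}) (QConfig {s // s ∉ M}) ℂ :=
  Matrix.of fun a b => u (glueConfig M a b)

lemma dotProduct_eq_sum_glueConfig (M : Finset V) (f g : QConfig V → ℂ) :
    f ⬝ᵥ g = ∑ a, ∑ b, f (glueConfig M a b) * g (glueConfig M a b) := by
  rw [dotProduct, ← (splitConfig M).symm.sum_comp, Fintype.sum_prod_type]
  rfl

lemma onRegion_mulVec_apply (M : Finset V) (A : QOp {s // s ∈ M}) (v : QConfig V → ℂ)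
    (a : QConfig {s // s ∈ M}) (b : QConfig {s // s ∉ M}) :
    (onRegion M A).mulVec v (glueConfig M a b) = (A * bipartite M v) a b := by
  rw [Matrix.mulVec, dotProduct_eq_sum_glueConfig M, Matrix.mul_apply]
  refine Finset.sum_congr rfl fun a' _ => ?_
  have key (b') : onRegion M A (glueConfig M a b) (glueConfig M a' b') =
      A a a' * (1 : QOp {s // s ∉ M}) b b' := by
    rw [← splitConfig_symm_apply M (a, b), ← splitConfig_symm_apply M (a', b')]
    change (Matrix.kroneckerMap _ _ _).submatrix _ _ _ _ = _
    simp
  simp only [key]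
  rw [Finset.sum_eq_single b]
  · simp [bipartite]
  · intro b' _ hb
    simp [Matrix.one_apply_ne hb.symm]
  · simp

lemma offRegion_mulVec_apply (M : Finset V) (B : QOp {s // s ∉ M}) (v : QConfig V → ℂ)
    (a : QConfig {s // s ∈ M}) (b : QConfig {s // s ∉ M}) :
    (offRegion M B).mulVec v (glueConfig M a b) = (bipartite M v * B.transpose) a b := by
  rw [Matrix.mulVec, dotProduct_eq_sum_glueConfig M, Finset.sum_comm, Matrix.mul_apply]
  refine Finset.sum_congr rfl fun b' _ => ?_
  have key (a') : offRegion M B (glueConfig M a b) (glueConfig M a' b') =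
      (1 : QOp {s // s ∈ M}) a a' * B b b' := by
    rw [← splitConfig_symm_apply M (a, b), ← splitConfig_symm_apply M (a', b')]
    simp [offRegion]
  simp only [key]
  rw [Finset.sum_eq_single a]
  · simp [bipartite, mul_comm]
  · intro b' _ hb
    simp [Matrix.one_apply_ne hb.symm]
  · simp

lemma dotProduct_onRegion_single (M : Finset V) (u v : QConfig V → ℂ)
    (a b : QConfig {s // s ∈ M}) :
    star u ⬝ᵥ (onRegion M (Matrix.single a b 1)).mulVec v =
      (bipartite M v * (bipartite M u).conjTranspose) b a := by
  rw [dotProduct_eq_sum_glueConfig M, Matrix.mul_apply, Finset.sum_eq_single a]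
  · refine Finset.sum_congr rfl fun c _ => ?_
    rw [onRegion_mulVec_apply, Matrix.single_mul_apply_same]
    simp [bipartite, mul_comm]
  · intro a' _ ha
    refine Finset.sum_eq_zero fun c _ => ?_
    rw [onRegion_mulVec_apply, Matrix.single_mul_apply_of_ne _ _ _ _ _ ha, mul_zero]
  · simp

lemma dotProduct_offRegion_single (M : Finset V) (u v : QConfig V → ℂ)
    (a b : QConfig {s // s ∉ M}) :
    star u ⬝ᵥ (offRegion M (Matrix.single a b 1)).mulVec v =
      ((bipartite M u).conjTranspose * bipartite M v) a b := by
  rw [dotProduct_eq_sum_glueConfig M, Matrix.mul_apply]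
  refine Finset.sum_congr rfl fun c _ => ?_
  rw [Finset.sum_eq_single a]
  · rw [offRegion_mulVec_apply, Matrix.transpose_single, Matrix.mul_single_apply_same]
    simp [bipartite]
  · intro a' _ ha
    rw [offRegion_mulVec_apply, Matrix.transpose_single,
      Matrix.mul_single_apply_of_ne _ _ _ _ _ ha, mul_zero]
  · simp

/-- A form of the no-cloning theorem: no two nonzero orthogonal code vectors exist if both a region
and its complement satisfy the Knill–Laflamme condition. With `X` and `Y` the matrices of the two
vectors, the condition on the complement gives `Xᴴ * Y = 0`, and the one on the region makes
`Y * Yᴴ` a multiple of `X * Xᴴ`, so that `Y * Yᴴ * Y = 0`. -/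
lemma KnillLaflamme.eq_zero_of_compl (hQ : IsStarProjection Q) (hM : KnillLaflamme Q M)
    (hMc : KnillLaflamme Q Mᶜ) {u v : QConfig V → ℂ} (hu : Q.mulVec u = u) (hv : Q.mulVec v = v)
    (hu0 : u ≠ 0) (huv : star u ⬝ᵥ v = 0) : v = 0 := by
  set X := bipartite M u
  set Y := bipartite M v
  have hXY : X.conjTranspose * Y = 0 := by
    ext a b
    obtain ⟨c, hc⟩ := hMc.exists_dotProduct hQ (supportedOn_compl_iff.2 ⟨Matrix.single a b 1, rfl⟩)
    rw [← dotProduct_offRegion_single M u v, hc u v hu hv, huv, mul_zero, Matrix.zero_apply]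
  have huu : star u ⬝ᵥ u ≠ 0 := fun h => hu0 (dotProduct_star_self_eq_zero.1 h)
  have hYY : Y * Y.conjTranspose =
      ((star v ⬝ᵥ v) / (star u ⬝ᵥ u)) • (X * X.conjTranspose) := by
    ext b a
    obtain ⟨c, hc⟩ := hM.exists_dotProduct hQ
      (supportedOn_iff_exists_onRegion.2 ⟨Matrix.single a b 1, rfl⟩)
    rw [Matrix.smul_apply, ← dotProduct_onRegion_single M v v, ← dotProduct_onRegion_single M u u,
      hc v v hv hv, hc u u hu hu, smul_eq_mul]
    field_simp
  have h0 : Y * Y.conjTranspose * Y = 0 := by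
    rw [hYY, Matrix.smul_mul, Matrix.mul_assoc, hXY, Matrix.mul_zero, smul_zero]
  have hY : Y = 0 := by
    rwa [Matrix.self_mul_conjTranspose_mul_eq_zero, Matrix.conjTranspose_mul_self_eq_zero] at h0
  ext x
  have h := congrFun (congrFun hY ((splitConfig M x).1)) ((splitConfig M x).2)
  have hx : glueConfig M (splitConfig M x).1 (splitConfig M x).2 = x := by
    rw [← splitConfig_symm_apply, Equiv.symm_apply_apply]
  change v (glueConfig M _ _) = 0 at h
  rwa [hx] at h

end KnillLaflamme

/-! ### Correctable regions satisfy the Knill–Laflamme condition -/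

section Correctable

lemma Complex.eq_zero_of_forall_nonneg_add_mul {c z : ℂ} (h : ∀ r : ℝ, 0 ≤ c + r * z) : z = 0 := by
  have him : z.im = 0 := by
    have h0 := (Complex.le_def.1 (h 0)).2
    have h1 := (Complex.le_def.1 (h 1)).2
    simp at h0 h1
    linarith
  have hre : z.re = 0 := by
    by_contra hne
    have h1 := (Complex.le_def.1 (h (-(c.re + 1) / z.re))).1
    rw [Complex.add_re, Complex.re_ofReal_mul, div_mul_cancel₀ _ hne, Complex.zero_re] at h1
    linarith
  exact Complex.ext hre him

variable {n : Type} [Fintype n] [DecidableEq n]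

omit [Fintype n] [DecidableEq n] in
/-- The Cauchy–Schwarz argument for a functional which is nonnegative on the matrices `x xᴴ`: if
it vanishes on `v vᴴ`, it vanishes on `v yᴴ` and `y vᴴ`. -/
lemma map_vecMulVec_eq_zero (ψ : Matrix n n ℂ →ₗ[ℂ] ℂ)
    (hψ : ∀ x, 0 ≤ ψ (Matrix.vecMulVec x (star x))) {v : n → ℂ}
    (hv : ψ (Matrix.vecMulVec v (star v)) = 0) (y : n → ℂ) :
    ψ (Matrix.vecMulVec v (star y)) = 0 ∧ ψ (Matrix.vecMulVec y (star v)) = 0 := by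
  set a := ψ (Matrix.vecMulVec v (star y))
  set b := ψ (Matrix.vecMulVec y (star v))
  have hexp (t : ℂ) : ψ (Matrix.vecMulVec (y + t • v) (star (y + t • v))) =
      ψ (Matrix.vecMulVec y (star y)) + (t * a + star t * b) := by
    rw [star_add, star_smul, Matrix.add_vecMulVec, Matrix.vecMulVec_add, Matrix.vecMulVec_add,
      Matrix.smul_vecMulVec, Matrix.smul_vecMulVec, Matrix.vecMulVec_smul, Matrix.vecMulVec_smul,
      map_add, map_add, map_add, map_smul, map_smul, map_smul, map_smul, hv]
    simp only [smul_eq_mul, mul_zero, add_zero, a, b]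
    ring
  have h1 : a + b = 0 := by
    refine Complex.eq_zero_of_forall_nonneg_add_mul (c := ψ (Matrix.vecMulVec y (star y)))
      fun r => ?_
    have h := hψ (y + (r : ℂ) • v)
    rw [hexp] at h
    convert h using 2
    simp only [Complex.star_def, Complex.conj_ofReal]
    ring
  have h2 : Complex.I * (a - b) = 0 := by
    refine Complex.eq_zero_of_forall_nonneg_add_mul (c := ψ (Matrix.vecMulVec y (star y)))
      fun r => ?_
    have h := hψ (y + (r * Complex.I : ℂ) • v)
    rw [hexp] at h
    convert h using 2
    simp only [Complex.star_def, map_mul, Complex.conj_ofReal, Complex.conj_I]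
    ring
  have h3 : a - b = 0 := (mul_eq_zero.1 h2).resolve_left Complex.I_ne_zero
  constructor
  · linear_combination (h1 + h3) / 2
  · linear_combination (h1 - h3) / 2

/-- Positive trace-preserving maps do not improve distinguishability: if `Φ` fixes `v vᴴ` and
maps `y yᴴ` to a state orthogonal to `v`, then `y` is orthogonal to `v`. -/
lemma dotProduct_eq_zero_of_positive_tracePreserving (Φ : Matrix n n ℂ →ₗ[ℂ] Matrix n n ℂ)
    (hpos : ∀ x, (Φ (Matrix.vecMulVec x (star x))).PosSemidef)
    (htr : ∀ X, (Φ X).trace = X.trace) {v y : n → ℂ}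
    (hv : Φ (Matrix.vecMulVec v (star v)) = Matrix.vecMulVec v (star v))
    (hy : star v ⬝ᵥ (Φ (Matrix.vecMulVec y (star y))).mulVec v = 0) : star v ⬝ᵥ y = 0 := by
  by_cases hv0 : v = 0
  · simp [hv0]
  have hN : star v ⬝ᵥ v ≠ 0 := fun h => hv0 (dotProduct_star_self_eq_zero.1 h)
  set N := star v ⬝ᵥ v with hNdef
  -- The overlap with `v`, and the trace of the compression to the complement of `v`.
  let φ : Matrix n n ℂ →ₗ[ℂ] ℂ :=
    { toFun := fun X => star v ⬝ᵥ (Φ X).mulVec v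
      map_add' := fun X Y => by rw [map_add, Matrix.add_mulVec, dotProduct_add]
      map_smul' := fun c X => by
        rw [map_smul, Matrix.smul_mulVec, dotProduct_smul, RingHom.id_apply] }
  set A : Matrix n n ℂ := N • 1 - Matrix.vecMulVec v (star v) with hA
  let ψ : Matrix n n ℂ →ₗ[ℂ] ℂ :=
    { toFun := fun X => (A * Φ X * A).trace
      map_add' := fun X Y => by rw [map_add, mul_add, add_mul, Matrix.trace_add]
      map_smul' := fun c X => by
        rw [map_smul, Matrix.mul_smul, Matrix.smul_mul, Matrix.trace_smul, RingHom.id_apply] }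
  have hNs : star N = N := by
    rw [hNdef, ← Matrix.star_dotProduct_star, star_star]
  have hAh : A.conjTranspose = A := by
    rw [hA, Matrix.conjTranspose_sub, Matrix.conjTranspose_smul, hNs, Matrix.conjTranspose_one,
      Matrix.conjTranspose_vecMulVec, star_star]
  have hAv : A.mulVec v = 0 := by
    rw [hA, Matrix.sub_mulVec, Matrix.smul_mulVec, Matrix.one_mulVec, Matrix.vecMulVec_mulVec]
    simp [hNdef]
  have hAA : A * A = N • A := by
    conv_lhs => rw [hA]
    rw [mul_sub, Matrix.mul_smul, mul_one, Matrix.mul_vecMulVec, ← hA, hAv]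
    simp
  have hφ := map_vecMulVec_eq_zero φ (fun x => (hpos x).dotProduct_mulVec_nonneg v) hy v
  have hψ := map_vecMulVec_eq_zero ψ (v := v) (fun x => by
      have h := ((hpos x).mul_mul_conjTranspose_same A).trace_nonneg
      rwa [hAh] at h) (by
      change (A * Φ _ * A).trace = 0
      rw [hv, Matrix.mul_vecMulVec, hAv]
      simp) y
  have h1 : (A * Φ (Matrix.vecMulVec y (star v)) * A).trace = 0 := hψ.2
  have h2 : star v ⬝ᵥ (Φ (Matrix.vecMulVec y (star v))).mulVec v = 0 := hφ.1
  rw [Matrix.trace_mul_comm, ← mul_assoc, hAA, Matrix.smul_mul, Matrix.trace_smul, smul_eq_mul,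
    mul_eq_zero] at h1
  have h3 := h1.resolve_left hN
  rw [hA, sub_mul, Matrix.smul_mul, one_mul, Matrix.trace_sub, Matrix.trace_smul, htr,
    Matrix.vecMulVec_mul, Matrix.trace_vecMulVec, Matrix.trace_vecMulVec] at h3
  rw [dotProduct_comm v, ← Matrix.dotProduct_mulVec, h2, sub_zero, smul_eq_mul, mul_eq_zero] at h3
  rw [dotProduct_comm]
  exact h3.resolve_left hN

/-- An operator without matrix elements between orthogonal vectors in the range of `Q` is
compressed to a scalar by `Q`. -/
lemma exists_compression_eq_smul {Q O : Matrix n n ℂ} (hQ : IsStarProjection Q)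
    (h : ∀ u v, Q.mulVec u = u → Q.mulVec v = v → star v ⬝ᵥ u = 0 → star v ⬝ᵥ O.mulVec u = 0) :
    ∃ c : ℂ, Q * O * Q = c • Q := by
  have hQQ : Q * Q = Q := hQ.isIdempotentElem.eq
  have hQs : Matrix.conjTranspose Q = Q := hQ.isSelfAdjoint.star_eq
  have hmove (x y : n → ℂ) (hx : Q.mulVec x = x) : star x ⬝ᵥ Q.mulVec y = star x ⬝ᵥ y := by
    rw [Matrix.dotProduct_mulVec, ← hQs, ← Matrix.star_mulVec, hx]
  let W := LinearMap.range Q.mulVecLin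
  have hW (w : W) : Q.mulVec w = w := by
    obtain ⟨w, x, rfl⟩ := w
    change Q.mulVec (Q.mulVec x) = Q.mulVec x
    rw [Matrix.mulVec_mulVec, hQQ]
  let f : W →ₗ[ℂ] W := ((Q * O).mulVecLin.comp W.subtype).codRestrict W fun w =>
    ⟨O.mulVec w, by
      change Q.mulVec (O.mulVec w) = (Q * O).mulVec w
      rw [Matrix.mulVec_mulVec]⟩
  have hf (w : W) : (f w : n → ℂ) = Q.mulVec (O.mulVec w) := by
    change (Q * O).mulVec w = _
    rw [Matrix.mulVec_mulVec]
  obtain ⟨c, hc⟩ := LinearMap.exists_eq_smul_id_of_forall_notLinearIndependent (f := f)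
    fun w hli => by
      rw [LinearIndependent.pair_iff] at hli
      set x : W := (-(star (w : n → ℂ) ⬝ᵥ O.mulVec w)) • w +
        (star (w : n → ℂ) ⬝ᵥ (w : n → ℂ)) • f w with hx
      have hzx (z : W) : star (z : n → ℂ) ⬝ᵥ (x : n → ℂ) =
          -(star (w : n → ℂ) ⬝ᵥ O.mulVec w) * (star (z : n → ℂ) ⬝ᵥ (w : n → ℂ)) +
          (star (w : n → ℂ) ⬝ᵥ (w : n → ℂ)) * (star (z : n → ℂ) ⬝ᵥ O.mulVec w) := by
        rw [hx, Submodule.coe_add, Submodule.coe_smul, Submodule.coe_smul, hf, dotProduct_add,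
          dotProduct_smul, dotProduct_smul, hmove _ _ (hW z), smul_eq_mul, smul_eq_mul]
      have hwx : star (w : n → ℂ) ⬝ᵥ (x : n → ℂ) = 0 := by
        rw [hzx w]
        ring
      have hxw : star (x : n → ℂ) ⬝ᵥ (w : n → ℂ) = 0 := by
        have h := Matrix.star_dotProduct_star (x : n → ℂ) (star (w : n → ℂ))
        rwa [star_star, hwx, star_zero] at h
      have hxx : star (x : n → ℂ) ⬝ᵥ (x : n → ℂ) = 0 := by
        rw [hzx x, hxw, h _ _ (hW w) (hW x) hxw, mul_zero, mul_zero, add_zero]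
      have hx0 : x = 0 := Subtype.ext (dotProduct_star_self_eq_zero.1 hxx)
      have hw0 : w = 0 := Subtype.ext (dotProduct_star_self_eq_zero.1 (hli _ _ hx0).2)
      exact one_ne_zero (hli 1 0 (by simp [hw0])).1
  refine ⟨c, Matrix.ext_of_mulVec_single fun i => ?_⟩
  have hi := congrArg (Subtype.val) (LinearMap.congr_fun hc ⟨Q.mulVec (Pi.single i 1), _, rfl⟩)
  rw [hf] at hi
  rw [← Matrix.mulVec_mulVec, ← Matrix.mulVec_mulVec, Matrix.smul_mulVec]
  exact hi

variable {V : Type} [Fintype V] [DecidableEq V]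

/-- The partial trace as a linear map. -/
def eraseQubitsLin (M : Finset V) : QOp V →ₗ[ℂ] QOp {s // s ∉ M} where
  toFun := eraseQubits M
  map_add' X Y := by
    ext x y
    simp [eraseQubits, Finset.sum_add_distrib]
  map_smul' c X := by
    ext x y
    simp [eraseQubits, Finset.mul_sum]

omit [Fintype V] in
lemma eraseQubits_posSemidef (M : Finset V) {X : QOp V} (hX : X.PosSemidef) :
    (eraseQubits M X).PosSemidef := by
  have h : eraseQubits M X = ∑ m, X.submatrix (glueConfig M m) (glueConfig M m) := by
    ext x y
    simp [eraseQubits, Matrix.sum_apply]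
  rw [h]
  exact Matrix.posSemidef_sum _ fun m _ => hX.submatrix _

lemma trace_eraseQubits (M : Finset V) (X : QOp V) : (eraseQubits M X).trace = X.trace := by
  rw [Matrix.trace, Matrix.trace, ← (splitConfig M).symm.sum_comp, Fintype.sum_prod_type_right]
  rfl

lemma IsCompletelyPositive.posSemidef {α β : Type} {Φ : Matrix α α ℂ →ₗ[ℂ] Matrix β β ℂ}
    (hΦ : IsCompletelyPositive Φ) {X : Matrix α α ℂ} (hX : X.PosSemidef) : (Φ X).PosSemidef :=
  (hΦ 1 _ (hX.submatrix Prod.snd)).submatrix fun b => (0, b)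

/-- Applying all matrix units `|a⟩⟨b|` of the erased region, for a fixed `a`, does not change the
state that is left after the erasure. -/
lemma sum_eraseQubits_onRegion_single (M : Finset V) (u : QConfig V → ℂ)
    (a : QConfig {s // s ∈ M}) :
    ∑ b, eraseQubits M (Matrix.vecMulVec ((onRegion M (Matrix.single a b 1)).mulVec u)
      (star ((onRegion M (Matrix.single a b 1)).mulVec u))) =
    eraseQubits M (Matrix.vecMulVec u (star u)) := by
  ext x y
  rw [Matrix.sum_apply]
  refine Finset.sum_congr rfl fun b _ => ?_
  rw [eraseQubits, Matrix.of_apply, Finset.sum_eq_single a]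
  · simp only [Matrix.vecMulVec_apply, Pi.star_apply, onRegion_mulVec_apply,
      Matrix.single_mul_apply_same, one_mul]
    rfl
  · intro a' _ ha
    rw [Matrix.vecMulVec_apply, onRegion_mulVec_apply, Matrix.single_mul_apply_of_ne _ _ _ _ _ ha,
      zero_mul]
  · simp

/-- If a positive trace-preserving map reverses the erasure of `M` on the code vectors, then `M`
satisfies the Knill–Laflamme condition. For orthogonal code vectors `u` and `v`, the vectors
`|a⟩⟨b| u` are indistinguishable from `u` after the erasure, hence are orthogonal to `v`. -/
lemma knillLaflamme_of_recovery {Q : QOp V} (hQ : IsStarProjection Q) {M : Finset V}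
    (R : QOp {s // s ∉ M} →ₗ[ℂ] QOp V) (hpos : ∀ X, X.PosSemidef → (R X).PosSemidef)
    (htr : IsTracePreserving R)
    (hR : ∀ u, Q.mulVec u = u →
      R (eraseQubits M (Matrix.vecMulVec u (star u))) = Matrix.vecMulVec u (star u)) :
    KnillLaflamme Q M := by
  intro O hO
  obtain ⟨A, rfl⟩ := supportedOn_iff_exists_onRegion.1 hO
  refine exists_compression_eq_smul hQ fun u v hu hv hvu => ?_
  have hpos' (x : QConfig V → ℂ) :
      (R (eraseQubits M (Matrix.vecMulVec x (star x)))).PosSemidef :=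
    hpos _ (eraseQubits_posSemidef M (Matrix.posSemidef_vecMulVec_self_star x))
  have hunit (a b) : star v ⬝ᵥ (onRegion M (Matrix.single a b 1)).mulVec u = 0 := by
    refine dotProduct_eq_zero_of_positive_tracePreserving (R ∘ₗ eraseQubitsLin M) hpos'
      (fun X => (htr _).trans (trace_eraseQubits M X)) (hR v hv) ?_
    have hsum : ∑ b, star v ⬝ᵥ (R (eraseQubits M
        (Matrix.vecMulVec ((onRegion M (Matrix.single a b 1)).mulVec u)
          (star ((onRegion M (Matrix.single a b 1)).mulVec u))))).mulVec v = 0 := by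
      rw [← dotProduct_sum, ← Matrix.sum_mulVec, ← map_sum, sum_eraseQubits_onRegion_single,
        hR u hu, Matrix.vecMulVec_mulVec]
      simp [hvu]
    exact (Finset.sum_eq_zero_iff_of_nonneg fun b _ =>
      (hpos' _).dotProduct_mulVec_nonneg v).1 hsum b (Finset.mem_univ b)
  rw [Matrix.matrix_eq_sum_single A, map_sum, Matrix.sum_mulVec, dotProduct_sum]
  refine Finset.sum_eq_zero fun a _ => ?_
  rw [map_sum, Matrix.sum_mulVec, dotProduct_sum]
  refine Finset.sum_eq_zero fun b _ => ?_
  have : Matrix.single a b (A a b) = A a b • Matrix.single a b 1 := by simp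
  rw [this, map_smul, Matrix.smul_mulVec, dotProduct_smul, hunit, smul_zero]

end Correctable

/-! ### Unitary operators from operators in a region -/

section Cayley

variable {n : Type} [Fintype n] [DecidableEq n]

lemma Matrix.IsHermitian.isUnit_add_I_smul_one {A : Matrix n n ℂ} (hA : A.IsHermitian) :
    IsUnit (A + Complex.I • (1 : Matrix n n ℂ)) := by
  have hpd : (A * A + 1).PosDef := by
    have h := Matrix.posSemidef_conjTranspose_mul_self A
    rw [hA.eq] at h
    exact Matrix.PosDef.posSemidef_add h .one
  have hprod : (A - Complex.I • (1 : Matrix n n ℂ)) * (A + Complex.I • (1 : Matrix n n ℂ)) =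
      A * A + 1 := by
    simp only [mul_add, sub_mul, Matrix.mul_smul, Matrix.smul_mul, one_mul, mul_one,
      smul_smul, Complex.I_mul_I]
    module
  rw [Matrix.isUnit_iff_isUnit_det]
  have h := (Matrix.isUnit_iff_isUnit_det _).1 hpd.isUnit
  rw [← hprod, Matrix.det_mul] at h
  exact isUnit_of_mul_isUnit_right h

omit [Fintype n] in
lemma Matrix.IsHermitian.conjTranspose_add_I_smul_one {A : Matrix n n ℂ} (hA : A.IsHermitian) :
    (A + Complex.I • (1 : Matrix n n ℂ)).conjTranspose = A - Complex.I • (1 : Matrix n n ℂ) := by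
  rw [Matrix.conjTranspose_add, Matrix.conjTranspose_smul, Matrix.conjTranspose_one, hA.eq,
    Complex.star_def, Complex.conj_I, neg_smul, sub_eq_add_neg]

/-- The Cayley transform `(A - i)(A + i)⁻¹`. -/
noncomputable def cayleyTransform (A : Matrix n n ℂ) : Matrix n n ℂ :=
  (A - Complex.I • (1 : Matrix n n ℂ)) * (A + Complex.I • (1 : Matrix n n ℂ))⁻¹

lemma cayleyTransform_mul {A : Matrix n n ℂ} (hA : A.IsHermitian) :
    cayleyTransform A * (A + Complex.I • (1 : Matrix n n ℂ)) =
      A - Complex.I • (1 : Matrix n n ℂ) := by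
  rw [cayleyTransform, mul_assoc, Matrix.nonsing_inv_mul _
    ((Matrix.isUnit_iff_isUnit_det _).1 hA.isUnit_add_I_smul_one), mul_one]

lemma star_cayleyTransform_mul_self {A : Matrix n n ℂ} (hA : A.IsHermitian) :
    star (cayleyTransform A) * cayleyTransform A = 1 := by
  set Z := A + Complex.I • (1 : Matrix n n ℂ) with hZ
  have hdet := (Matrix.isUnit_iff_isUnit_det _).1 hA.isUnit_add_I_smul_one
  have hZs : Z.conjTranspose = A - Complex.I • (1 : Matrix n n ℂ) :=
    hA.conjTranspose_add_I_smul_one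
  have hcomm : Z * Z.conjTranspose = Z.conjTranspose * Z := by
    rw [hZs, hZ]
    simp only [mul_add, mul_sub, add_mul, sub_mul, Matrix.mul_smul, Matrix.smul_mul, one_mul,
      mul_one]
    abel
  have hinv : Z⁻¹.conjTranspose * Z.conjTranspose = 1 := by
    rw [← Matrix.conjTranspose_mul, Matrix.mul_nonsing_inv _ hdet, Matrix.conjTranspose_one]
  rw [cayleyTransform, ← hZs, ← hZ, Matrix.star_eq_conjTranspose, Matrix.conjTranspose_mul,
    Matrix.conjTranspose_conjTranspose]
  calc Z⁻¹.conjTranspose * Z * (Z.conjTranspose * Z⁻¹)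
      = Z⁻¹.conjTranspose * (Z * Z.conjTranspose) * Z⁻¹ := by simp only [mul_assoc]
    _ = (Z⁻¹.conjTranspose * Z.conjTranspose) * (Z * Z⁻¹) := by rw [hcomm]; simp only [mul_assoc]
    _ = 1 := by rw [hinv, Matrix.mul_nonsing_inv _ hdet, one_mul]

end Cayley

section UnitaryOnRegion

variable {V : Type} [Fintype V] [DecidableEq V] {M : Finset V} {T : Finset (QOp V)} {Q : QOp V}

/-- An operator on `M` that commutes with the self-adjoint elements of `T` and does not act as a
scalar on a nonzero space of vectors fixed by `Q` may be replaced by a unitary one: one of the two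
Hermitian parts of the operator is not a scalar either, and neither is its Cayley transform. -/
lemma exists_unitary_of_not_smul (hQ0 : Q ≠ 0) (hQQ : Q * Q = Q)
    (hT : ∀ P ∈ T, star P = P) {O : QOp V} (hO : SupportedOn M O)
    (hOT : ∀ P ∈ T, Commute O P) (hQT : ∀ X, (∀ P ∈ T, Commute X P) → Commute X Q)
    (hns : ¬ ∃ c : ℂ, O * Q = c • Q) :
    ∃ U ∈ Matrix.unitaryGroup (QConfig V) ℂ, SupportedOn M U ∧ (∀ P ∈ T, Commute U P) ∧
      ¬ ∃ c : ℂ, U * Q = c • Q := by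
  obtain ⟨A, rfl⟩ := supportedOn_iff_exists_onRegion.1 hO
  have hstar : ∀ P ∈ T, Commute (onRegion M (star A)) P := fun P hP => by
    rw [map_star]
    have h := (hOT P hP).star_star
    rwa [hT P hP] at h
  obtain ⟨H, hH, hHT, hHns⟩ : ∃ H : QOp {s // s ∈ M}, H.IsHermitian ∧
      (∀ P ∈ T, Commute (onRegion M H) P) ∧ ¬ ∃ c : ℂ, onRegion M H * Q = c • Q := by
    by_contra! hcon
    obtain ⟨c, hc⟩ := hcon (A + star A) (IsSelfAdjoint.add_star_self A) fun P hP => by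
      rw [map_add]
      exact (hOT P hP).add_left (hstar P hP)
    obtain ⟨d, hd⟩ := hcon (Complex.I • (A - star A))
      (by
        rw [Matrix.IsHermitian, ← Matrix.star_eq_conjTranspose, star_smul, star_sub, star_star,
          Complex.star_def, Complex.conj_I, neg_smul, ← smul_neg, neg_sub]) fun P hP => by
      rw [map_smul, map_sub]
      exact ((hOT P hP).sub_left (hstar P hP)).smul_left _
    refine hns ⟨(c - Complex.I * d) / 2, ?_⟩
    rw [map_add, add_mul] at hc
    rw [map_smul, map_sub, smul_mul_assoc, sub_mul] at hd
    have hd' : onRegion M A * Q - onRegion M (star A) * Q = (-(Complex.I * d)) • Q := by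
      have h := congrArg (fun X : QOp V => (-Complex.I) • X) hd
      simpa [smul_smul] using h
    have h2 : (2 : ℂ) • (onRegion M A * Q) = (c - Complex.I * d) • Q := by
      rw [sub_eq_add_neg, add_smul, ← hc, ← hd']
      module
    rw [div_eq_inv_mul, mul_smul, ← h2, smul_smul]
    norm_num
  have hIT {P : QOp V} : Commute (onRegion M (Complex.I • 1)) P := by
    rw [map_smul, map_one]
    exact (Commute.one_left P).smul_left _
  have hUT : ∀ P ∈ T, Commute (onRegion M (cayleyTransform H)) P := fun P hP => by
    have hadd : Commute (onRegion M (H + Complex.I • 1)) P := by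
      rw [map_add]
      exact (hHT P hP).add_left hIT
    have hsub : Commute (onRegion M (H - Complex.I • 1)) P := by
      rw [map_sub]
      exact (hHT P hP).sub_left hIT
    rw [cayleyTransform, map_mul]
    refine hsub.mul_left ?_
    have hdet := (Matrix.isUnit_iff_isUnit_det _).1 hH.isUnit_add_I_smul_one
    have h1 := congrArg (onRegion M) (Matrix.nonsing_inv_mul _ hdet)
    have h2 := congrArg (onRegion M) (Matrix.mul_nonsing_inv _ hdet)
    rw [map_mul, map_one] at h1 h2
    set Y := onRegion M (H + Complex.I • 1)
    set Z := onRegion M (H + Complex.I • 1)⁻¹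
    calc Z * P = Z * P * (Y * Z) := by rw [h2, mul_one]
      _ = Z * (P * Y) * Z := by simp only [mul_assoc]
      _ = (Z * Y) * P * Z := by rw [← hadd.eq]; simp only [mul_assoc]
      _ = P * Z := by rw [h1, one_mul]
  refine ⟨onRegion M (cayleyTransform H), ?_, supportedOn_iff_exists_onRegion.2 ⟨_, rfl⟩, hUT, ?_⟩
  · rw [Matrix.mem_unitaryGroup_iff', ← map_star, ← map_mul, star_cayleyTransform_mul_self hH,
      map_one]
  · rintro ⟨c, hc⟩
    set U := onRegion M (cayleyTransform H)
    set K := onRegion M H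
    have hU : U * (K + Complex.I • 1) = K - Complex.I • 1 := by
      have h := congrArg (onRegion M) (cayleyTransform_mul hH)
      rwa [map_mul, map_add, map_sub, map_smul, map_one] at h
    have hKQ : Commute K Q := hQT K hHT
    have hKQ' : Q * K * Q = K * Q := by rw [← hKQ.eq, mul_assoc, hQQ]
    -- `U` acts as `c` on the range of `Q`, which `K + i` preserves.
    have h1 : c • (K * Q + Complex.I • Q) = K * Q - Complex.I • Q := by
      have h := congrArg (· * Q) hU
      simp only [add_mul, sub_mul, mul_add, smul_mul_assoc, mul_smul_comm, mul_one, one_mul] at h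
      rw [mul_assoc U K Q, hKQ.eq, ← mul_assoc, hc, smul_mul_assoc, ← hKQ.eq] at h
      rw [← h]
      module
    have hc1 : (1 - c) • (K * Q) = (Complex.I * (1 + c)) • Q := by
      have h : (1 - c) • (K * Q) - (Complex.I * (1 + c)) • Q =
          (K * Q - Complex.I • Q) - c • (K * Q + Complex.I • Q) := by module
      rwa [h1, sub_self, sub_eq_zero] at h
    by_cases hc' : 1 - c = 0
    · have hc2 : c = 1 := (sub_eq_zero.1 hc').symm
      rw [hc2, sub_self, zero_smul] at hc1
      exact (smul_ne_zero (by norm_num) hQ0) hc1.symm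
    · refine hHns ⟨(1 - c)⁻¹ * (Complex.I * (1 + c)), ?_⟩
      rw [mul_smul, ← hc1, smul_smul, inv_mul_cancel₀ hc', one_smul]

end UnitaryOnRegion

/-! ### Blocks of sites along the first coordinate -/

section Blocks

/-- The block of the coordinate `x` when `0, …, L - 1` is cut into an even number of intervals:
all have length `m` except the last one, whose length is in `[m, 3m)`. -/
def blockIndex (L m x : ℕ) : ℕ := min (x / m) (2 * (L / (2 * m)) - 1)

variable {b : BoundaryCondition} {L m : ℕ}

lemma mem_coordRange_of_le {i r : ℕ} {x : Fin L} (h₁ : i ≤ (x : ℕ)) (h₂ : (x : ℕ) < i + r) :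
    x ∈ coordRange b L i r := by
  cases b with
  | openBoundary => exact ⟨h₁, h₂⟩
  | periodicBoundary =>
    exact ⟨x - i, by omega, by rw [Nat.add_sub_cancel' h₁, Nat.mod_eq_of_lt x.2]⟩

/-- Coordinates in a common range of length `m + 1` are at distance at most `m`, measured around
the circle for periodic boundary conditions. -/
lemma le_add_of_mem_coordRange (hm : m < L) {i : ℕ} (hi : i < L) {x y : Fin L}
    (hx : x ∈ coordRange b L i (m + 1)) (hy : y ∈ coordRange b L i (m + 1)) :
    ((x : ℕ) ≤ y + m ∧ (y : ℕ) ≤ x + m) ∨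
      (b = .periodicBoundary ∧ ((x : ℕ) + L ≤ y + m ∨ (y : ℕ) + L ≤ x + m)) := by
  cases b with
  | openBoundary =>
    obtain ⟨h₁, h₂⟩ := hx
    obtain ⟨h₃, h₄⟩ := hy
    omega
  | periodicBoundary =>
    obtain ⟨t, ht, hxt⟩ := hx
    obtain ⟨u, hu, hyu⟩ := hy
    have hmod {t : ℕ} (ht : t < m + 1) : (i + t) % L = i + t ∨ (i + t) % L + L = i + t := by
      rcases lt_or_ge (i + t) L with h | h
      · exact .inl (Nat.mod_eq_of_lt h)
      · right
        rw [Nat.mod_eq_sub_mod h, Nat.mod_eq_of_lt (by omega)]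
        omega
    have h₁ := hmod ht
    have h₂ := hmod hu
    simp only [true_and]
    omega

lemma blockIndex_mul_le (L m x : ℕ) : blockIndex L m x * m ≤ x :=
  (Nat.mul_le_mul_right m (min_le_left _ _)).trans (Nat.div_mul_le_self x m)

lemma lt_blockIndex_mul_add (hm : 0 < m) {x : ℕ} (hx : x < L) :
    x < blockIndex L m x * m + 3 * m := by
  rcases le_total (x / m) (2 * (L / (2 * m)) - 1) with h | h
  · have h₁ := Nat.div_add_mod x m
    have h₂ := Nat.mod_lt x hm
    rw [blockIndex, min_eq_left h, mul_comm]
    omega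
  · rw [blockIndex, min_eq_right h]
    have h₁ := Nat.div_add_mod L (2 * m)
    have h₂ := Nat.mod_lt L (show 0 < 2 * m by omega)
    rw [Nat.sub_mul, show 2 * (L / (2 * m)) * m = 2 * m * (L / (2 * m)) by ring]
    omega

/-- The even number of blocks makes neighbouring blocks differ in parity, also across the periodic
boundary. -/
lemma blockIndex_eq_of_mem_coordRange (hm : 0 < m) (hL : 3 * m < L) {i : ℕ} (hi : i < L)
    {x y : Fin L} (hx : x ∈ coordRange b L i (m + 1)) (hy : y ∈ coordRange b L i (m + 1))
    (hxy : blockIndex L m x % 2 = blockIndex L m y % 2) :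
    blockIndex L m x = blockIndex L m y := by
  have hadj {x y : ℕ} (h : x ≤ y + m) : x / m ≤ y / m + 1 := by
    rw [← Nat.add_div_right y hm]
    exact Nat.div_le_div_right h
  have hk : 1 ≤ L / (2 * m) := (Nat.one_le_div_iff (by omega)).2 (by omega)
  have hwrap {x y : ℕ} (hy : y < L) (h : x + L ≤ y + m) :
      blockIndex L m x = 0 ∧ blockIndex L m y = 2 * (L / (2 * m)) - 1 := by
    constructor
    · rw [blockIndex, Nat.div_eq_of_lt (by omega), Nat.zero_min]
    · refine min_eq_right ((Nat.le_div_iff_mul_le hm).2 ?_)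
      have h₁ := Nat.div_add_mod L (2 * m)
      rw [Nat.sub_mul, show 2 * (L / (2 * m)) * m = 2 * m * (L / (2 * m)) by ring]
      omega
  rcases le_add_of_mem_coordRange (by omega) hi hx hy with ⟨h₁, h₂⟩ | ⟨-, h | h⟩
  · have h₃ := hadj h₁
    have h₄ := hadj h₂
    unfold blockIndex at *
    omega
  · obtain ⟨h₁, h₂⟩ := hwrap y.2 h
    omega
  · obtain ⟨h₁, h₂⟩ := hwrap x.2 h
    omega

lemma exists_coordRange_of_blockIndex (b : BoundaryCondition) (hm : 0 < m) (hL : 3 * m < L)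
    (j : ℕ) : ∃ i : Fin L, (b = .openBoundary → (i : ℕ) + min (3 * m) L ≤ L) ∧
      ∀ x : Fin L, blockIndex L m x = j → x ∈ coordRange b L i (min (3 * m) L) := by
  rw [min_eq_left hL.le]
  refine ⟨⟨min (j * m) (L - 3 * m), by omega⟩, fun _ => ?_, fun x hx => ?_⟩
  · simp only
    omega
  · have h₁ := blockIndex_mul_le L m x
    have h₂ := lt_blockIndex_mul_add hm x.2
    rw [hx] at h₁ h₂
    have h₃ := x.2
    exact mem_coordRange_of_le (by simp only; omega) (by simp only; omega)

/-- A range of length `5 * m` contains all coordinates that share a range of length `m + 1` with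
a coordinate of a given block. -/
lemma exists_coordRange_of_neighbor (b : BoundaryCondition) (hm : 0 < m) (hL : 3 * m < L)
    (j : ℕ) : ∃ i : Fin L, (b = .openBoundary → (i : ℕ) + min (5 * m) L ≤ L) ∧
      ∀ c x y : Fin L, blockIndex L m x = j → x ∈ coordRange b L c (m + 1) →
        y ∈ coordRange b L c (m + 1) → y ∈ coordRange b L i (min (5 * m) L) := by
  rcases le_total L (5 * m) with h5 | h5
  · rw [min_eq_right h5]
    exact ⟨⟨0, by omega⟩, by simp, fun c x y _ _ _ =>
      mem_coordRange_of_le (Nat.zero_le _) (by simp)⟩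
  rw [min_eq_left h5]
  -- The block lies in the range of length `3 * m` that starts at `s`.
  set s := min (j * m) (L - 3 * m) with hs
  have hblock {x : Fin L} (hx : blockIndex L m x = j) : s ≤ x ∧ (x : ℕ) < s + 3 * m := by
    have h₁ := blockIndex_mul_le L m x
    have h₂ := lt_blockIndex_mul_add hm x.2
    rw [hx] at h₁ h₂
    have h₃ := x.2
    omega
  cases b with
  | openBoundary =>
    refine ⟨⟨min (s - m) (L - 5 * m), by omega⟩, fun _ => by simp only; omega,
      fun c x y hx hxc hyc => ?_⟩
    obtain ⟨h₁, h₂⟩ := hblock hx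
    have h₃ := y.2
    rcases le_add_of_mem_coordRange (by omega) c.2 hxc hyc with h | h
    · exact mem_coordRange_of_le (by simp only; omega) (by simp only; omega)
    · exact absurd h.1 (by simp)
  | periodicBoundary =>
    refine ⟨⟨(s + L - m) % L, Nat.mod_lt _ (by omega)⟩, by simp, fun c x y hx hxc hyc => ?_⟩
    obtain ⟨h₁, h₂⟩ := hblock hx
    have h₃ := y.2
    have h₄ := x.2
    have hmem {t k : ℕ} (ht : t < 5 * m) (hk : s + L - m + t = y + k * L) :
        y ∈ coordRange .periodicBoundary L ((s + L - m) % L) (5 * m) := by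
      refine ⟨t, ht, ?_⟩
      rw [Nat.mod_add_mod, hk, Nat.add_mul_mod_self_right, Nat.mod_eq_of_lt h₃]
    rcases le_add_of_mem_coordRange (by omega) c.2 hxc hyc with h | ⟨-, h | h⟩
    · exact hmem (t := y + m - s) (k := 1) (by omega) (by omega)
    · exact hmem (t := y + m - s - L) (k := 0) (by omega) (by omega)
    · exact hmem (t := y + L + m - s) (k := 2) (by omega) (by omega)

end Blocks

/-! ### Slabs and lattice codes -/

namespace LocalCommutingProjectorCode

variable {b : BoundaryCondition} {D L w : ℕ}

section Lattice

variable {m : ℕ}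

/-- The sites whose first coordinate lies in a given block. -/
def blockSites (D L m : ℕ) (hD : 1 ≤ D) (j : ℕ) : Finset (LatticeSite D L) :=
  Finset.univ.filter fun x => blockIndex L m (x ⟨0, hD⟩) = j

/-- The sites in the blocks below `j` of a given parity. -/
def paritySites (D L m : ℕ) (hD : 1 ≤ D) (p j : ℕ) : Finset (LatticeSite D L) :=
  Finset.univ.filter fun x =>
    blockIndex L m (x ⟨0, hD⟩) % 2 = p ∧ blockIndex L m (x ⟨0, hD⟩) < j

lemma apply_mem_coordRange_of_mem_hypercube {c x : LatticeSite D L} (h : x ∈ hypercube b w c)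
    (j : Fin D) : x j ∈ coordRange b L (c j) w := by
  classical
  unfold hypercube at h
  exact (Finset.mem_filter.1 h).2 j

lemma exists_isSlab_of_coordRange (hD : 1 ≤ D) {r : ℕ} (i : Fin L)
    (hi : b = .openBoundary → (i : ℕ) + min r L ≤ L) :
    ∃ S : Finset (LatticeSite D L), IsSlab b hD (min r L) S ∧
      ∀ x, x ∈ S ↔ x ⟨0, hD⟩ ∈ coordRange b L i (min r L) := by
  classical
  have h (x : LatticeSite D L) : x ∈ Finset.univ.filter
      (fun x : LatticeSite D L => x ⟨0, hD⟩ ∈ coordRange b L i (min r L)) ↔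
      x ⟨0, hD⟩ ∈ coordRange b L i (min r L) := by simp
  exact ⟨_, ⟨min_le_right _ _, i, hi, h⟩, h⟩

lemma isSlab_univ (b : BoundaryCondition) (hD : 1 ≤ D) {r : ℕ} (hL : 0 < L) (hr : L ≤ r) :
    IsSlab b hD (min r L) (Finset.univ : Finset (LatticeSite D L)) := by
  rw [min_eq_right hr]
  refine ⟨le_rfl, ⟨0, hL⟩, by simp, fun x => ?_⟩
  simp only [Finset.mem_univ, true_iff]
  exact mem_coordRange_of_le (Nat.zero_le _) (by simp)

lemma card_coordRange_le {i r : ℕ} (S : Finset (Fin L)) (hS : ∀ x ∈ S, x ∈ coordRange b L i r) :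
    S.card ≤ r := by
  rw [← Finset.card_range r, ← Finset.card_image_of_injective S Fin.val_injective]
  cases b with
  | openBoundary =>
    refine (Finset.card_le_card (t := Finset.Ico i (i + r)) fun n hn => ?_).trans (by simp)
    obtain ⟨x, hx, rfl⟩ := Finset.mem_image.1 hn
    exact Finset.mem_Ico.2 (hS x hx)
  | periodicBoundary =>
    refine (Finset.card_le_card (t := (Finset.range r).image fun t => (i + t) % L)
      fun n hn => ?_).trans Finset.card_image_le
    obtain ⟨x, hx, rfl⟩ := Finset.mem_image.1 hn
    obtain ⟨t, ht, hxt⟩ := hS x hx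
    exact Finset.mem_image.2 ⟨t, Finset.mem_range.2 ht, hxt.symm⟩

lemma card_le_of_isSlab (hD : 1 ≤ D) {r : ℕ} {S : Finset (LatticeSite D L)}
    (hS : IsSlab b hD r S) : S.card ≤ r * L ^ (D - 1) := by
  classical
  obtain ⟨-, i, -, hi⟩ := hS
  obtain ⟨D, rfl⟩ : ∃ k, D = k + 1 := ⟨D - 1, by omega⟩
  set A : Finset (Fin L) := Finset.univ.filter fun x => x ∈ coordRange b L i r
  have hA : A.card ≤ r := card_coordRange_le A fun x hx => (Finset.mem_filter.1 hx).2
  have hcard : S.card ≤ (A ×ˢ (Finset.univ : Finset (Fin D → Fin L))).card := by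
    refine Finset.card_le_card_of_injOn (fun x => (x 0, fun k => x k.succ)) (fun x hx => ?_)
      fun x _ y _ hxy => ?_
    · simpa [A] using (hi x).1 hx
    · rw [Prod.mk.injEq] at hxy
      funext k
      exact Fin.cases hxy.1 (fun k => congrFun hxy.2 k) k
  rw [Finset.card_product, Finset.card_univ, Fintype.card_fun, Fintype.card_fin,
    Fintype.card_fin] at hcard
  exact hcard.trans (Nat.mul_le_mul_right _ hA)

end Lattice

variable (C : LocalCommutingProjectorCode b D L w)

lemma exists_codeProjection : ∃ Q, IsJointProjection C.projectors Q :=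
  exists_isJointProjection _ C.isProjection C.commute

variable {C} {Q : QOp (LatticeSite D L)}

lemma mem_codeSpace_iff (hQ : IsJointProjection C.projectors Q)
    (v : QConfig (LatticeSite D L) → ℂ) : v ∈ C.codeSpace ↔ Q.mulVec v = v :=
  hQ.mulVec_eq_iff.symm

lemma knillLaflamme_of_isCorrectable (hQ : IsJointProjection C.projectors Q)
    {M : Finset (LatticeSite D L)} (hM : C.IsCorrectable M) : KnillLaflamme Q M := by
  obtain ⟨R, hcp, htp, hR⟩ := hM
  refine knillLaflamme_of_recovery hQ.isStarProjection R (fun X => hcp.posSemidef) htp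
    fun u hu => ?_
  by_cases hu0 : u = 0
  · rw [hu0, Matrix.zero_vecMulVec]
    exact (congrArg R (map_zero (eraseQubitsLin M))).trans (map_zero R)
  have hN : star u ⬝ᵥ u ≠ 0 := fun h => hu0 (dotProduct_star_self_eq_zero.1 h)
  have hNnn : 0 ≤ (star u ⬝ᵥ u)⁻¹ := by
    have h : (0 : ℂ) ≤ star u ⬝ᵥ u := dotProduct_star_self_nonneg u
    exact inv_nonneg.2 h
  -- The normalization of `u uᴴ` is a code state.
  have h := hR ((star u ⬝ᵥ u)⁻¹ • Matrix.vecMulVec u (star u))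
    ⟨(Matrix.posSemidef_vecMulVec_self_star u).smul hNnn, by
      rw [Matrix.trace_smul, Matrix.trace_vecMulVec, dotProduct_comm u (star u), smul_eq_mul,
        inv_mul_cancel₀ hN], fun v => by
      rw [Matrix.smul_mulVec, Matrix.vecMulVec_mulVec, op_smul_eq_smul, smul_smul]
      exact C.codeSpace.smul_mem _ ((mem_codeSpace_iff hQ u).2 hu)⟩
  have h' : R (eraseQubitsLin M ((star u ⬝ᵥ u)⁻¹ • Matrix.vecMulVec u (star u))) =
    (star u ⬝ᵥ u)⁻¹ • Matrix.vecMulVec u (star u) := h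
  rw [map_smul, map_smul] at h'
  exact smul_right_injective _ (inv_ne_zero hN) h'

/-- A nontrivial code has two orthogonal nonzero code vectors. -/
lemma exists_orthogonal_of_isNontrivial (hC : C.IsNontrivial) :
    ∃ u ∈ C.codeSpace, ∃ v ∈ C.codeSpace, u ≠ 0 ∧ v ≠ 0 ∧ star u ⬝ᵥ v = 0 := by
  have hpos : 0 < Module.finrank ℂ C.codeSpace := zero_lt_one.trans hC
  have := Module.finrank_pos_iff.1 hpos
  obtain ⟨u, hu⟩ := exists_ne (0 : C.codeSpace)
  obtain ⟨v, hv⟩ : ∃ v : C.codeSpace, ∀ c : ℂ, c • u ≠ v := by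
    by_contra! hcon
    exact (finrank_le_one u hcon).not_gt hC
  have hu0 : (u : QConfig (LatticeSite D L) → ℂ) ≠ 0 := fun h => hu (Subtype.ext h)
  have hN : star (u : QConfig (LatticeSite D L) → ℂ) ⬝ᵥ (u : QConfig (LatticeSite D L) → ℂ) ≠ 0 :=
    fun h => hu0 (dotProduct_star_self_eq_zero.1 h)
  set c := (star (u : QConfig (LatticeSite D L) → ℂ) ⬝ᵥ (v : QConfig (LatticeSite D L) → ℂ)) /
    (star (u : QConfig (LatticeSite D L) → ℂ) ⬝ᵥ (u : QConfig (LatticeSite D L) → ℂ)) with hc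
  refine ⟨u, u.2, v - c • u, (v - c • u).2, hu0, fun h => hv c ?_, ?_⟩
  · exact (sub_eq_zero.1 (Subtype.ext h : v - c • u = 0)).symm
  · rw [dotProduct_sub, dotProduct_smul, smul_eq_mul, hc, div_mul_cancel₀ _ hN, sub_self]

lemma not_knillLaflamme_and_compl (hQ : IsJointProjection C.projectors Q) (hC : C.IsNontrivial)
    {M : Finset (LatticeSite D L)} (hM : KnillLaflamme Q M) : ¬ KnillLaflamme Q Mᶜ := by
  intro hMc
  obtain ⟨u, hu, v, hv, hu0, hv0, huv⟩ := exists_orthogonal_of_isNontrivial hC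
  rw [mem_codeSpace_iff hQ] at hu hv
  exact hv0 (hM.eq_zero_of_compl hQ.isStarProjection hMc hu hv hu0 huv)

/-- Blocks of the same parity are far enough apart for no projector to touch two of them. -/
lemma knillLaflamme_paritySites {m : ℕ} (hm : 0 < m) (hL : 3 * m < L) (hD : 1 ≤ D)
    {C : LocalCommutingProjectorCode b D L (m + 1)} (hQ : IsJointProjection C.projectors Q)
    (h : ∀ j, KnillLaflamme Q (blockSites D L m hD j)) (p j : ℕ) :
    KnillLaflamme Q (paritySites D L m hD p j) := by
  induction j with
  | zero =>
    have : paritySites D L m hD p 0 = ∅ := by simp [paritySites]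
    rw [this]
    exact knillLaflamme_empty hQ.mul_self
  | succ j ih =>
    by_cases hj : j % 2 = p
    · refine (ih.union hQ C.isProjection C.commute (N := blockSites D L m hD j) ?_
        (fun P hP => ?_) (h j)).mono fun x hx => ?_
      · rw [Finset.disjoint_left]
        intro x hx hx'
        simp only [paritySites, blockSites, Finset.mem_filter] at hx hx'
        omega
      · obtain ⟨c, hc⟩ := C.local_range P hP
        by_cases hd : Disjoint (hypercube b (m + 1) c) (paritySites D L m hD p j)
        · exact .inl fun O hO => hc.commute hd hO
        · refine .inr fun O hO => hc.commute ?_ hO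
          obtain ⟨x, hxc, hx⟩ := Finset.not_disjoint_iff.1 hd
          rw [Finset.disjoint_left]
          intro y hyc hy
          simp only [paritySites, blockSites, Finset.mem_filter] at hx hy
          have := blockIndex_eq_of_mem_coordRange hm hL (c ⟨0, hD⟩).2
            (apply_mem_coordRange_of_mem_hypercube hxc ⟨0, hD⟩)
            (apply_mem_coordRange_of_mem_hypercube hyc ⟨0, hD⟩) (by omega)
          omega
      · simp only [paritySites, blockSites, Finset.mem_union, Finset.mem_filter,
          Finset.mem_univ, true_and] at hx ⊢
        omega
    · refine ih.mono fun x hx => ?_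
      simp only [paritySites, Finset.mem_filter, Finset.mem_univ, true_and] at hx ⊢
      refine ⟨hx.1, lt_of_le_of_ne (Nat.lt_succ_iff.1 hx.2) fun he => hj ?_⟩
      rw [← he]
      exact hx.1

lemma exists_block_not_knillLaflamme {m : ℕ} (hm : 0 < m) (hL : 3 * m < L) (hD : 1 ≤ D)
    {C : LocalCommutingProjectorCode b D L (m + 1)} (hQ : IsJointProjection C.projectors Q)
    (hC : C.IsNontrivial) : ∃ j, ¬ KnillLaflamme Q (blockSites D L m hD j) := by
  by_contra! h
  have hp (p) := knillLaflamme_paritySites hm hL hD hQ h p (L + 1)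
  refine not_knillLaflamme_and_compl hQ hC (hp 0) ((hp 1).mono fun x hx => ?_)
  have hlt : blockIndex L m (x ⟨0, hD⟩) < L + 1 :=
    ((min_le_left _ _).trans (Nat.div_le_self _ _)).trans_lt (by omega)
  simp only [paritySites, Finset.mem_compl, Finset.mem_filter, Finset.mem_univ, true_and] at hx ⊢
  omega

/-- A region that violates the Knill–Laflamme condition and fits into a slab of width `3 * m`,
while the projectors touching it fit into a slab of width `5 * m`. -/
lemma exists_region_not_knillLaflamme {m : ℕ} (hm : 0 < m) (hD : 1 ≤ D)
    {C : LocalCommutingProjectorCode b D L (m + 1)} (hQ : IsJointProjection C.projectors Q)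
    (hC : C.IsNontrivial) : ∃ B : Finset (LatticeSite D L), ¬ KnillLaflamme Q B ∧
      (∃ S, IsSlab b hD (min (3 * m) L) S ∧ B ⊆ S) ∧
      ∃ S, IsSlab b hD (min (5 * m) L) S ∧ B ⊆ S ∧
        ∀ c, ¬ Disjoint (hypercube b (m + 1) c) B → hypercube b (m + 1) c ⊆ S := by
  have hL0 : 0 < L := by
    rcases Nat.eq_zero_or_pos L with rfl | h
    · have : IsEmpty (LatticeSite D 0) := ⟨fun x => (x ⟨0, hD⟩).elim0⟩
      have h1 := C.codeSpace.finrank_le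
      rw [Module.finrank_fintype_fun_eq_card, Fintype.card_unique] at h1
      exact absurd hC h1.not_gt
    · exact h
  rcases le_or_gt L (3 * m) with hL | hL
  · refine ⟨Finset.univ, ?_, ⟨Finset.univ, isSlab_univ b hD hL0 hL, subset_rfl⟩,
      Finset.univ, isSlab_univ b hD hL0 (by omega), subset_rfl, fun c _ => Finset.subset_univ _⟩
    rw [← Finset.compl_empty]
    exact not_knillLaflamme_and_compl hQ hC (knillLaflamme_empty hQ.mul_self)
  · obtain ⟨j, hj⟩ := exists_block_not_knillLaflamme hm hL hD hQ hC
    obtain ⟨i, hi, hi'⟩ := exists_coordRange_of_blockIndex b hm hL j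
    obtain ⟨S, hS, hS'⟩ := exists_isSlab_of_coordRange (D := D) hD i hi
    obtain ⟨k, hk, hk'⟩ := exists_coordRange_of_neighbor b hm hL j
    obtain ⟨S₂, hS₂, hS₂'⟩ := exists_isSlab_of_coordRange (D := D) hD k hk
    refine ⟨_, hj, ⟨S, hS, fun x hx => (hS' x).2 (hi' _ (Finset.mem_filter.1 hx).2)⟩, S₂, hS₂,
      fun x hx => ?_, fun c hc y hy => ?_⟩
    · have hx0 : x ⟨0, hD⟩ ∈ coordRange b L (x ⟨0, hD⟩) (m + 1) :=
        mem_coordRange_of_le le_rfl (by omega)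
      exact (hS₂' x).2 (hk' _ _ _ (Finset.mem_filter.1 hx).2 hx0 hx0)
    · obtain ⟨x, hxc, hx⟩ := Finset.not_disjoint_iff.1 hc
      exact (hS₂' y).2 (hk' _ _ _ (Finset.mem_filter.1 hx).2
        (apply_mem_coordRange_of_mem_hypercube hxc _)
        (apply_mem_coordRange_of_mem_hypercube hy _))

/-- If `B` violates the Knill–Laflamme condition, then conjugating an operator on `B` with
nontrivial compression by the product of the projectors that touch `B` gives an operator that
commutes with all projectors. -/
lemma exists_unitary_of_not_knillLaflamme (hQ : IsJointProjection C.projectors Q)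
    (hC : C.IsNontrivial) {B S : Finset (LatticeSite D L)} (hB : ¬ KnillLaflamme Q B)
    (hBS : B ⊆ S) (hS : ∀ c, ¬ Disjoint (hypercube b w c) B → hypercube b w c ⊆ S) :
    ∃ U : QOp (LatticeSite D L), U ∈ Matrix.unitaryGroup (QConfig (LatticeSite D L)) ℂ ∧
      SupportedOn S U ∧ (∀ P ∈ C.projectors, Commute U P) ∧ C.IsNontrivialLogical U := by
  classical
  have hmem (v) := mem_codeSpace_iff hQ v
  simp only [KnillLaflamme, not_forall] at hB
  obtain ⟨O, hO, hOns⟩ := hB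
  set T := C.projectors.filter fun P => ¬ ∃ c, SupportedOn (hypercube b w c) P ∧
    Disjoint (hypercube b w c) B
  have hTC : T ⊆ C.projectors := Finset.filter_subset _ _
  obtain ⟨K, hK⟩ := exists_isJointProjection T (fun P hP => C.isProjection P (hTC hP))
    fun P hP R hR => C.commute P (hTC hP) R (hTC hR)
  have hKQ : K * Q = Q := hQ.mul_eq_of_subset hK hTC
  have hQK : Q * K = Q := by
    have h := congrArg star hKQ
    rwa [star_mul, hQ.isStarProjection.isSelfAdjoint.star_eq,
      hK.isStarProjection.isSelfAdjoint.star_eq] at h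
  have hKS : SupportedOn S K := by
    refine Submonoid.closure_induction (motive := fun Y _ => SupportedOn S Y) (fun P hP => ?_)
      (supportedOn_iff_exists_onRegion.2 ⟨1, map_one _⟩) (fun X Y _ _ hX hY => ?_) hK.mem_closure
    · obtain ⟨hPC, hP⟩ := Finset.mem_filter.1 hP
      obtain ⟨c, hc⟩ := C.local_range P hPC
      exact hc.mono (hS c fun hd => hP ⟨c, hc, hd⟩)
    · exact hX.mul hY
  have hcomm : ∀ P ∈ C.projectors, Commute (K * O * K) P := by
    intro P hP
    by_cases hPT : P ∈ T
    · rw [commute_iff_eq, mul_assoc, hK.mul_of_mem hPT (C.isProjection P hP), ← mul_assoc P,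
        ← mul_assoc P, hK.mul_eq_self P hPT]
    · have hPK : Commute K P := hK.commute fun R hR => C.commute R (hTC hR) P hP
      obtain ⟨c, hc, hd⟩ : ∃ c, SupportedOn (hypercube b w c) P ∧
          Disjoint (hypercube b w c) B := by
        by_contra h
        exact hPT (Finset.mem_filter.2 ⟨hP, h⟩)
      exact (hPK.mul_left (hc.commute hd hO).symm).mul_left hPK
  obtain ⟨u, hu, -, -, hu0, -⟩ := exists_orthogonal_of_isNontrivial hC
  have hQ0 : Q ≠ 0 := fun h => hu0 (by
    rw [← (hmem u).1 hu, h, Matrix.zero_mulVec])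
  obtain ⟨U, hU, hUS, hUC, hUns⟩ := exists_unitary_of_not_smul hQ0 hQ.mul_self
    (fun P hP => (C.isProjection P hP).isSelfAdjoint.star_eq)
    ((hKS.mul (hO.mono hBS)).mul hKS) hcomm
    (fun X hX => (hQ.commute fun P hP => (hX P hP).symm).symm) (by
      rintro ⟨c, hc⟩
      refine hOns ⟨c, ?_⟩
      calc Q * O * Q = Q * (K * O * K * Q) := by
            simp only [mul_assoc, hKQ]
            rw [← mul_assoc Q K, hQK]
        _ = c • Q := by rw [hc, mul_smul_comm, hQ.mul_self])
  refine ⟨U, hU, hUS, hUC, fun v hv P hP => ?_, ?_⟩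
  · rw [Matrix.mulVec_mulVec, ← (hUC P hP).eq, ← Matrix.mulVec_mulVec, hv P hP]
  · rintro ⟨c, hc⟩
    refine hUns ⟨c, Matrix.ext_of_mulVec_single fun i => ?_⟩
    rw [← Matrix.mulVec_mulVec, Matrix.smul_mulVec]
    exact hc _ ((hmem _).2 (by rw [Matrix.mulVec_mulVec, hQ.mul_self]))

end LocalCommutingProjectorCode

theorem theorem3 (b : BoundaryCondition) (D L w : ℕ) (hD : 1 ≤ D) (hw : 1 < w)
    (C : LocalCommutingProjectorCode b D L w) (hC : C.IsNontrivial) :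
    (∃ S : Finset (LatticeSite D L), IsSlab b hD (min (5 * (w - 1)) L) S ∧
      ∃ U : QOp (LatticeSite D L), U ∈ Matrix.unitaryGroup (QConfig (LatticeSite D L)) ℂ ∧
        SupportedOn S U ∧ (∀ P ∈ C.projectors, Commute U P) ∧ C.IsNontrivialLogical U) ∧
    (∃ S : Finset (LatticeSite D L), IsSlab b hD (min (3 * (w - 1)) L) S ∧
      ¬ C.IsCorrectable S) ∧
    (∃ d : ℕ, C.IsDistance d ∧ d ≤ 3 * (w - 1) * L ^ (D - 1)) := by
  obtain ⟨m, rfl⟩ : ∃ m, w = m + 1 := ⟨w - 1, by omega⟩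
  rw [Nat.add_sub_cancel]
  obtain ⟨Q, hQ⟩ := C.exists_codeProjection
  obtain ⟨B, hB, ⟨S, hS, hBS⟩, S', hS', hBS', hcube⟩ :=
    LocalCommutingProjectorCode.exists_region_not_knillLaflamme (by omega) hD hQ hC
  have hnc : ¬ C.IsCorrectable S := fun h => hB
    ((LocalCommutingProjectorCode.knillLaflamme_of_isCorrectable hQ h).mono hBS)
  refine ⟨⟨S', hS', LocalCommutingProjectorCode.exists_unitary_of_not_knillLaflamme hQ hC hB hBS'
    hcube⟩, ⟨S, hS, hnc⟩, ?_⟩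
  have hmem : S.card ∈ {n : ℕ | ∃ M : Finset (LatticeSite D L), M.card = n ∧
      ¬ C.IsCorrectable M} := ⟨S, rfl, hnc⟩
  refine ⟨sInf _, ⟨Nat.sInf_mem ⟨_, hmem⟩, fun n hn => Nat.sInf_le hn⟩,
    (Nat.sInf_le hmem).trans ((LocalCommutingProjectorCode.card_le_of_isSlab hD hS).trans ?_)⟩
  exact Nat.mul_le_mul_right _ (min_le_left _ _)
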